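/- Let $D_1=\{X\in\mathbb R^2:|X|\le 1\}$ be the closed unit disc, $\mathbb S^2$ the unit sphere of $\mathbb R^3$, and let $W^{1,2}(D_1,\mathbb S^2)$ be the set of $\mathbf u\in W^{1,2}(D_1,\mathbb R^3)$ with $\mathbf u(X)\in\mathbb S^2$ for almost every $X\in D_1$. Let $C_0^\infty(D_1)$ be the set of smooth real functions with compact support in the open unit disc. For $\mathbf n\in W^{1,2}(D_1,\mathbb S^2)$ put $\Phi=\mathbf n\cdot(\partial_1\mathbf n\times\partial_2\mathbf n)\in L^1(D_1)$, where $\partial_i$ are weak partial derivatives, and $|\nabla\mathbf n|^2=|\partial_1\mathbf n|^2+|\partial_2\mathbf n|^2$. For $F\in L^1(D_1)$ let $$\|F\|_{W_0^{-1,2}(D_1)}=\sup\Big\{\Big|\int_{D_1}F\,\zeta\,dX\Big|:\ \zeta\in C_0^\infty(D_1),\ \|\nabla\zeta\|_{L^2(D_1)}\le 1\Big\}\in[0,\infty],$$ which is the norm of $F$ in the dual of $W^{1,2}_0(D_1)$ normed by $\|\nabla\zeta\|_{L^2(D_1)}$. There is an absolute constant $c>0$ such that the following holds for every $\delta>0$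 and every $\mathbf n\in W^{1,2}(D_1,\mathbb S^2)$ with $$\int_{D_1}|\partial_1\mathbf n\times\partial_2\mathbf n|\,dX\le 4\pi-\delta .$$ (i) There exist $\Omega_1,\Omega_2\in L^2(D_1)$ with $\|\Omega_i\|_{L^2(D_1)}\le\frac{8\pi}{\delta}\|\nabla\mathbf n\|_{L^2(D_1)}$ for $i=1,2$, such that for every $\zeta\in C_0^\infty(D_1)$ $$\int_{D_1}\Phi\,\zeta\,dX=\int_{D_1}\big(\Omega_2\,\partial_1\zeta-\Omega_1\,\partial_2\zeta\big)\,dX .$$ (ii) $\displaystyle\|\Phi\|_{W_0^{-1,2}(D_1)}\le\frac{c}{\delta}\,\|\nabla\mathbf n\|_{L^2(D_1)}$. -/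

import Mathlib

open MeasureTheory Set

open scoped ContDiff ENNReal

namespace WeakArea

noncomputable section

/-- The plane `ℝ²` with its Euclidean norm. -/
abbrev Plane : Type := EuclideanSpace ℝ (Fin 2)

/-- The space `ℝ³` with its Euclidean norm. -/
abbrev Space : Type := EuclideanSpace ℝ (Fin 3)

/-- The closed unit disc `D₁`. -/
def disc : Set Plane := Metric.closedBall 0 1

/-- Lebesgue measure `dX` on `D₁`. -/
def discMeasure : Measure Plane := volume.restrict disc

/-- `ζ ∈ C₀^∞(D₁)`: smooth, real-valued, with compact support in the open unit disc. -/
def IsTestFunction (ζ : Plane → ℝ) : Prop :=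
  ContDiff ℝ ∞ ζ ∧ HasCompactSupport ζ ∧ tsupport ζ ⊆ Metric.ball 0 1

/-- The classical partial derivative `∂ᵢζ`, used for test functions
(`i = 0, 1` are the first and the second coordinate). -/
def partialDeriv (i : Fin 2) (ζ : Plane → ℝ) (X : Plane) : ℝ :=
  fderiv ℝ ζ X (EuclideanSpace.single i 1)

/-- `v ∈ L²(D₁)` is a weak partial derivative `∂ᵢu` of `u` on `D₁`. -/
def IsWeakPartial (i : Fin 2) (u v : Plane → Space) : Prop :=
  MemLp v 2 discMeasure ∧
    ∀ ζ, IsTestFunction ζ →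
      ∫ X, partialDeriv i ζ X • u X ∂discMeasure = -∫ X, ζ X • v X ∂discMeasure

/-- `u ∈ W^{1,2}(D₁, ℝ³)`. -/
def MemW12 (u : Plane → Space) : Prop :=
  MemLp u 2 discMeasure ∧ ∀ i, ∃ v, IsWeakPartial i u v

/-- `u ∈ W^{1,2}(D₁, 𝕊²)`. -/
def MemW12Sphere (u : Plane → Space) : Prop :=
  MemW12 u ∧ ∀ᵐ X ∂discMeasure, u X ∈ Metric.sphere (0 : Space) 1

open Classical in
/-- The weak partial derivative `∂ᵢu` of `u ∈ W^{1,2}(D₁, ℝ³)` (some representative of it;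
any two agree almost everywhere on `D₁`). -/
def weakPartial (i : Fin 2) (u : Plane → Space) : Plane → Space :=
  if h : ∃ v, IsWeakPartial i u v then h.choose else 0

/-- `|∇u| = (|∂₁u|² + |∂₂u|²)^{1/2}`. -/
def gradNorm (u : Plane → Space) (X : Plane) : ℝ :=
  Real.sqrt (‖weakPartial 0 u X‖ ^ 2 + ‖weakPartial 1 u X‖ ^ 2)

/-- The vector product in `ℝ³`. -/
def cross (a b : Space) : Space := WithLp.toLp 2 (crossProduct a.ofLp b.ofLp)

/-- `Φ = n · (∂₁n × ∂₂n)`. -/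
def area (n : Plane → Space) (X : Plane) : ℝ :=
  inner ℝ (n X) (cross (weakPartial 0 n X) (weakPartial 1 n X))

/-- `|∇ζ|` for a test function `ζ`. -/
def testGradNorm (ζ : Plane → ℝ) (X : Plane) : ℝ :=
  Real.sqrt (partialDeriv 0 ζ X ^ 2 + partialDeriv 1 ζ X ^ 2)

/-- The norm of an integrable function `F` on `D₁` in the dual of `W₀^{1,2}(D₁)`, the completion
of `C₀^∞(D₁)` in the norm `‖∇ζ‖_{L²(D₁)}`: the supremum of `|∫ F ζ dX|` over test functions
with `‖∇ζ‖_{L²(D₁)} ≤ 1`. It is finite if and only if `ζ ↦ ∫ F ζ dX` extends to a continuous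
linear functional on `W₀^{1,2}(D₁)`, and is then the norm of that (unique) extension. -/
def negSobolevNorm (F : Plane → ℝ) : ℝ≥0∞ :=
  ⨆ (ζ : Plane → ℝ) (_ : IsTestFunction ζ) (_ : eLpNorm (testGradNorm ζ) 2 discMeasure ≤ 1),
    ENNReal.ofReal |∫ X, F X * ζ X ∂discMeasure|

theorem isWeakPartial_weakPartial {u : Plane → Space} (hu : MemW12 u) (i : Fin 2) :
    IsWeakPartial i u (weakPartial i u) := by
  have h := hu.2 i
  rw [weakPartial, dif_pos h]
  exact h.choose_spec

theorem discMeasure_eq : discMeasure = volume.restrict (Metric.ball (0 : Plane) 1) := by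
  unfold discMeasure disc
  refine Measure.restrict_congr_set ?_
  have h : volume (Metric.sphere (0 : Plane) 1) = 0 := Measure.addHaar_sphere _ _ _
  rw [← Metric.ball_union_sphere]
  exact union_ae_eq_left_of_ae_eq_empty (ae_eq_empty.2 h)

/-- Weak partial derivatives are unique up to null sets. -/
theorem IsWeakPartial.ae_eq {i : Fin 2} {u v w : Plane → Space} (hv : IsWeakPartial i u v)
    (hw : IsWeakPartial i u w) : v =ᵐ[discMeasure] w := by
  have hfin : IsFiniteMeasure discMeasure := by
    rw [discMeasure_eq]
    exact ⟨by simp [measure_ball_lt_top]⟩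
  have hvi : Integrable v discMeasure := hv.1.integrable (by norm_num)
  have hwi : Integrable w discMeasure := hw.1.integrable (by norm_num)
  have key := IsOpen.ae_eq_zero_of_integral_contDiff_smul_eq_zero (μ := (volume : Measure Plane))
    (f := v - w) (U := Metric.ball 0 1) Metric.isOpen_ball ?_ ?_
  · rw [discMeasure_eq]
    refine (ae_restrict_iff' measurableSet_ball).2 ?_
    filter_upwards [key] with X hX hXU
    exact sub_eq_zero.1 (hX hXU)
  · have : IntegrableOn (v - w) (Metric.ball 0 1) := by
      rw [IntegrableOn, ← discMeasure_eq]
      exact hvi.sub hwi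
    exact this.locallyIntegrableOn
  · intro g hg hgc hgs
    obtain ⟨C, hC⟩ := hg.continuous.bounded_above_of_compact_support hgc
    have hgm : AEStronglyMeasurable g discMeasure := hg.continuous.aestronglyMeasurable
    have e1 : ∫ X, g X • (v - w) X ∂discMeasure = 0 := by
      have h1 := hv.2 g ⟨hg, hgc, hgs⟩
      have h2 := hw.2 g ⟨hg, hgc, hgs⟩
      have i1 : Integrable (fun X => g X • v X) discMeasure :=
        hvi.bdd_smul C hgm (Filter.Eventually.of_forall hC)
      have i2 : Integrable (fun X => g X • w X) discMeasure :=
        hwi.bdd_smul C hgm (Filter.Eventually.of_forall hC)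
      simp only [Pi.sub_apply, smul_sub]
      rw [integral_sub i1 i2, sub_eq_zero]
      exact neg_injective (h1.symm.trans h2)
    rw [discMeasure_eq] at e1
    rw [← e1]
    refine (setIntegral_eq_integral_of_forall_compl_eq_zero ?_).symm
    intro X hX
    have : g X = 0 := by
      by_contra h0
      exact hX (hgs (subset_tsupport g h0))
    simp [this]

end

end WeakArea

/-! The solid angle form on space minus the origin is closed but not exact; it becomes exact after a
ray is removed. For a direction $q$ the field $A_q(y)=q\times y/(|q||y|^2-|y|\,q\cdot y)$ is
singular only on the ray through $q$, and its curl is $-y/|y|^3$ (`fderiv_potential_alternating`).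
If a smooth $u$ avoids that ray on the support of $\zeta$, Stokes' theorem moves the derivative from
$A_q$ to $\zeta$ and, for $|u|=1$, bounds $|\int\Phi\zeta|$ by $\int|A_q(u)||\nabla
u||\nabla\zeta|$.

No single direction gives a uniform bound, so one averages over $q$ in the unit ball. The bad $q$
lie in the cone over the image of $u$, whose volume is at most a third of the area $a$ swept out
(`volume_cone_le`); hence good $q$ fill at least $(4\pi-a)/3\ge\delta/3$. On the other side, $|A_q|$
is $\cot(\theta/2)$ on the unit sphere, $\theta$ being the angle to $q$, and its integral over all
$q$ in the ball is at most $2\pi^2/3$ (`lintegral_ball_norm_potential_le`). Chebyshev's inequality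
gives $\delta|\int\Phi\zeta|\le2\pi^2\int|\nabla u||\nabla\zeta|$.

A Sobolev map is mollified. The mollified maps leave the sphere and may pass through the origin, so
$A_q$ is multiplied by a cutoff that vanishes on the ball of radius $1/2$. The extra term carries
the derivative of the cutoff, which vanishes near the sphere, so it disappears in the limit
(`abs_integral_cutArea_le`, `abs_integral_areaOf_le`). The squared gradients are dominated by
mollifications of $|\nabla n|^2$, which converge almost everywhere with constant integral; this
suffices for `tendsto_integral_of_dominating_sequence`.

By Cauchy–Schwarz, $\zeta\mapsto\int\Phi\zeta$ is then bounded by $\|\nabla\zeta\|_{L^2}$. This is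
(ii), and Hahn–Banach with the Riesz representation yields (i). -/

open Filter Topology

namespace WeakArea

noncomputable section

/-! ### Vector algebra in three dimensions -/

theorem cross_zero_coord (a b : Space) : cross a b 0 = a 1 * b 2 - a 2 * b 1 := by
  simp [cross, cross_apply]

theorem cross_one_coord (a b : Space) : cross a b 1 = a 2 * b 0 - a 0 * b 2 := by
  simp [cross, cross_apply]

theorem cross_two_coord (a b : Space) : cross a b 2 = a 0 * b 1 - a 1 * b 0 := by
  simp [cross, cross_apply]

theorem inner_eq_coord (a b : Space) : inner ℝ a b = a 0 * b 0 + a 1 * b 1 + a 2 * b 2 := by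
  simp [PiLp.inner_apply, Fin.sum_univ_three, mul_comm]

theorem norm_sq_eq_coord (a : Space) : ‖a‖ ^ 2 = a 0 ^ 2 + a 1 ^ 2 + a 2 ^ 2 := by
  rw [← real_inner_self_eq_norm_sq, inner_eq_coord]; ring

theorem norm_cross_sq (a b : Space) :
    ‖cross a b‖ ^ 2 = ‖a‖ ^ 2 * ‖b‖ ^ 2 - (inner ℝ a b) ^ 2 := by
  rw [norm_sq_eq_coord, norm_sq_eq_coord, norm_sq_eq_coord, inner_eq_coord, cross_zero_coord,
    cross_one_coord, cross_two_coord]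
  ring

theorem norm_cross_le (a b : Space) : ‖cross a b‖ ≤ ‖a‖ * ‖b‖ := by
  refine le_of_sq_le_sq ?_ (by positivity)
  rw [norm_cross_sq, mul_pow]
  nlinarith [sq_nonneg (inner ℝ a b : ℝ)]

/-- The vector product as a continuous linear map in its second argument. -/
def crossL (q : Space) : Space →L[ℝ] Space :=
  LinearMap.toContinuousLinearMap
    { toFun := cross q
      map_add' := fun a b => by simp [cross]
      map_smul' := fun c a => by simp [cross] }

@[simp] theorem crossL_apply (q a : Space) : crossL q a = cross q a := rfl

theorem continuous_cross : Continuous fun p : Space × Space => cross p.1 p.2 := by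
  refine (PiLp.continuous_toLp 2 _).comp ?_
  refine continuous_pi fun i => ?_
  fin_cases i <;> simp [cross_apply] <;> fun_prop

/-! ### Vector potential of the solid angle form -/

/-- The reciprocal of the scalar factor of the vector potential of the solid angle form. -/
def potentialDenom (q y : Space) : ℝ := ‖q‖ * ‖y‖ ^ 2 - ‖y‖ * inner ℝ q y

/-- The vector potential of the solid angle form with singularity on the ray through `q`. -/
def potential (q y : Space) : Space := (potentialDenom q y)⁻¹ • cross q y

theorem hasFDerivAt_norm' {y : Space} (hy : y ≠ 0) :
    HasFDerivAt (fun z : Space => ‖z‖) (‖y‖⁻¹ • innerSL ℝ y) y := by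
  have h := (hasStrictFDerivAt_norm_sq y).hasFDerivAt.sqrt (by simpa using hy)
  have e : (fun z : Space => √(‖z‖ ^ 2)) = fun z => ‖z‖ := by
    ext z; exact Real.sqrt_sq (norm_nonneg z)
  rw [e] at h
  refine h.congr_fderiv ?_
  ext a
  have : ‖y‖ ≠ 0 := norm_ne_zero_iff.2 hy
  simp
  field_simp

theorem hasFDerivAt_potentialDenom (q : Space) {y : Space} (hy : y ≠ 0) :
    HasFDerivAt (potentialDenom q)
      ((2 * ‖q‖) • innerSL ℝ y - (‖y‖ • innerSL ℝ q + (inner ℝ q y : ℝ) • ‖y‖⁻¹ • innerSL ℝ y))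
      y := by
  have h1 := ((hasStrictFDerivAt_norm_sq y).hasFDerivAt.const_mul ‖q‖).sub
    ((hasFDerivAt_norm' hy).mul (innerSL ℝ q).hasFDerivAt)
  refine h1.congr_fderiv ?_
  ext a
  simp
  ring

theorem hasFDerivAt_potential (q : Space) {y : Space} (hy : y ≠ 0) (hD : potentialDenom q y ≠ 0) :
    HasFDerivAt (potential q)
      ((potentialDenom q y)⁻¹ • crossL q +
        (-(potentialDenom q y ^ 2)⁻¹ • ((2 * ‖q‖) • innerSL ℝ y -
          (‖y‖ • innerSL ℝ q + (inner ℝ q y : ℝ) • ‖y‖⁻¹ • innerSL ℝ y))).smulRight (cross q y))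
      y := by
  have h2 := ((hasDerivAt_inv hD).comp_hasFDerivAt y (hasFDerivAt_potentialDenom q hy)).smul
    (crossL q).hasFDerivAt
  exact h2

theorem contDiffAt_potential (q : Space) {y : Space} (hy : y ≠ 0) (hD : potentialDenom q y ≠ 0) :
    ContDiffAt ℝ ∞ (potential q) y := by
  have h1 : ContDiffAt ℝ ∞ (potentialDenom q) y := by
    unfold potentialDenom
    have hn : ContDiffAt ℝ ∞ (fun z : Space => ‖z‖) y := contDiffAt_norm ℝ hy
    exact (contDiffAt_const.mul (hn.pow 2)).sub (hn.mul (innerSL ℝ q).contDiff.contDiffAt)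
  exact (h1.inv hD).smul (crossL q).contDiff.contDiffAt

/-- Both sides equal $(v\times(q\times y))\cdot(a\times b)$: the left by Lagrange's identity, the
right by expanding the double vector product. -/
theorem inner_mul_inner_cross_sub (v q y a b : Space) :
    inner ℝ v a * inner ℝ (cross q y) b - inner ℝ v b * inner ℝ (cross q y) a =
      inner ℝ v y * inner ℝ q (cross a b) - inner ℝ v q * inner ℝ y (cross a b) := by
  simp only [inner_eq_coord, cross_zero_coord, cross_one_coord, cross_two_coord]
  ring

theorem inner_cross_left (q a b : Space) :
    inner ℝ (cross q a) b = inner ℝ q (cross a b) := by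
  simp only [inner_eq_coord, cross_zero_coord, cross_one_coord, cross_two_coord]
  ring

theorem inner_cross_swap (q a b : Space) :
    inner ℝ q (cross b a) = -inner ℝ q (cross a b) := by
  simp only [inner_eq_coord, cross_zero_coord, cross_one_coord, cross_two_coord]
  ring

/-- The curl of the vector potential is minus the solid angle field. -/
theorem fderiv_potential_alternating (q a b : Space) {y : Space} (hy : y ≠ 0)
    (hD : potentialDenom q y ≠ 0) :
    inner ℝ (fderiv ℝ (potential q) y a) b - inner ℝ (fderiv ℝ (potential q) y b) a =
      -((‖y‖ ^ 3)⁻¹ * inner ℝ y (cross a b)) := by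
  rw [(hasFDerivAt_potential q hy hD).fderiv]
  have hr : ‖y‖ ≠ 0 := norm_ne_zero_iff.2 hy
  have i1 := inner_mul_inner_cross_sub y q y a b
  have i2 := inner_mul_inner_cross_sub q q y a b
  rw [real_inner_self_eq_norm_sq, real_inner_comm q y] at i1
  rw [real_inner_self_eq_norm_sq] at i2
  simp only [_root_.add_apply, _root_.smul_apply,
    ContinuousLinearMap.smulRight_apply, _root_.sub_apply, crossL_apply,
    innerSL_apply_apply, inner_add_left, real_inner_smul_left, smul_eq_mul]
  have hD' : ‖q‖ * ‖y‖ - inner ℝ q y ≠ 0 := by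
    intro h
    apply hD
    unfold potentialDenom
    linear_combination ‖y‖ * h
  have hDdef : potentialDenom q y = ‖y‖ * (‖q‖ * ‖y‖ - inner ℝ q y) := by
    unfold potentialDenom; ring
  rw [hDdef, inner_cross_left q a b, inner_cross_left q b a, inner_cross_swap q a b]
  generalize (inner ℝ (cross q y) a : ℝ) = ca at *
  generalize (inner ℝ (cross q y) b : ℝ) = cb at *
  generalize (inner ℝ y (cross a b) : ℝ) = Y at *
  generalize (inner ℝ q (cross a b) : ℝ) = Q at *
  generalize (inner ℝ q y : ℝ) = m at *
  generalize ‖y‖ = r at *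
  generalize ‖q‖ = s at *
  generalize (inner ℝ y a : ℝ) = ya at *
  generalize (inner ℝ y b : ℝ) = yb at *
  generalize (inner ℝ q a : ℝ) = qa at *
  generalize (inner ℝ q b : ℝ) = qb at *
  -- With $d=|q||y|-q\cdot y$ as a variable, the denominators become products of powers of $|y|$ and
  -- $d$.
  obtain ⟨d, rfl⟩ : ∃ d, m = s * r - d := ⟨s * r - m, by ring⟩
  rw [sub_sub_cancel] at hD' ⊢
  field_simp
  linear_combination (-(s * r + d)) * i1 + r ^ 2 * i2

theorem norm_potential_sq (q y : Space) :
    ‖potential q y‖ ^ 2 =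
      (‖q‖ ^ 2 * ‖y‖ ^ 2 - (inner ℝ q y) ^ 2) / potentialDenom q y ^ 2 := by
  rw [potential, norm_smul, mul_pow, norm_cross_sq, norm_inv, Real.norm_eq_abs, inv_pow, sq_abs]
  field_simp

/-! ### Cutoff near the origin -/

/-- A smooth cutoff that vanishes on the ball of radius `1/2` and is `1` near the unit sphere. -/
def cutoff (y : Space) : ℝ := Real.smoothTransition (4 * ‖y‖ ^ 2 - 1)

theorem contDiff_cutoff : ContDiff ℝ ∞ cutoff := by
  unfold cutoff
  exact Real.smoothTransition.contDiff.comp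
    ((contDiff_const.mul (contDiff_norm_sq ℝ)).sub contDiff_const)

theorem cutoff_nonneg (y : Space) : 0 ≤ cutoff y := Real.smoothTransition.nonneg _

theorem cutoff_le_one (y : Space) : cutoff y ≤ 1 := Real.smoothTransition.le_one _

theorem cutoff_eq_zero {y : Space} (h : ‖y‖ ≤ 1 / 2) : cutoff y = 0 := by
  refine Real.smoothTransition.zero_of_nonpos ?_
  nlinarith [norm_nonneg y]

theorem cutoff_eq_one {y : Space} (h : 3 / 4 ≤ ‖y‖) : cutoff y = 1 := by
  refine Real.smoothTransition.one_of_one_le ?_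
  nlinarith [norm_nonneg y]

theorem fderiv_cutoff_eq_zero_of_lt {y : Space} (h : ‖y‖ < 1 / 2) : fderiv ℝ cutoff y = 0 := by
  have : cutoff =ᶠ[𝓝 y] fun _ => 0 := by
    filter_upwards [(continuous_norm.tendsto y).eventually_lt_const h] with z hz
    exact cutoff_eq_zero hz.le
  rw [this.fderiv_eq]; simp

theorem fderiv_cutoff_eq_zero_of_gt {y : Space} (h : 3 / 4 < ‖y‖) : fderiv ℝ cutoff y = 0 := by
  have : cutoff =ᶠ[𝓝 y] fun _ => 1 := by
    filter_upwards [(continuous_norm.tendsto y).eventually_const_lt h] with z hz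
    exact cutoff_eq_one hz.le
  rw [this.fderiv_eq]; simp

theorem exists_norm_fderiv_cutoff_le : ∃ C, ∀ y : Space, ‖fderiv ℝ cutoff y‖ ≤ C := by
  have hc : Continuous (fderiv ℝ cutoff) := contDiff_cutoff.continuous_fderiv (by simp)
  refine hc.bounded_above_of_compact_support ?_
  refine HasCompactSupport.intro (isCompact_closedBall (0 : Space) 1) fun y hy => ?_
  refine fderiv_cutoff_eq_zero_of_gt ?_
  simp at hy
  linarith

/-! ### Cylindrical and polar coordinates -/

/-- The point of space with horizontal part `X` and height `t`. -/
def spacePoint (X : Plane) (t : ℝ) : Space := !₂[X 0, X 1, t]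

@[simp] theorem spacePoint_zero (X : Plane) (t : ℝ) : spacePoint X t 0 = X 0 := rfl
@[simp] theorem spacePoint_one (X : Plane) (t : ℝ) : spacePoint X t 1 = X 1 := rfl
@[simp] theorem spacePoint_two (X : Plane) (t : ℝ) : spacePoint X t 2 = t := rfl

theorem plane_norm_sq (X : Plane) : ‖X‖ ^ 2 = X 0 ^ 2 + X 1 ^ 2 := by
  simp [EuclideanSpace.norm_sq_eq, Fin.sum_univ_two]

theorem norm_spacePoint_sq (X : Plane) (t : ℝ) : ‖spacePoint X t‖ ^ 2 = ‖X‖ ^ 2 + t ^ 2 := by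
  rw [norm_sq_eq_coord, plane_norm_sq]; simp

theorem continuous_spacePoint : Continuous fun p : Plane × ℝ => spacePoint p.1 p.2 := by
  unfold spacePoint
  refine (PiLp.continuous_toLp 2 _).comp ?_
  refine continuous_pi fun i => ?_
  fin_cases i <;> simp <;> fun_prop

theorem lintegral_space {f : Space → ℝ≥0∞} (hf : Measurable f) :
    ∫⁻ y, f y = ∫⁻ X : Plane, ∫⁻ t : ℝ, f (spacePoint X t) := by
  rw [← (PiLp.volume_preserving_toLp (Fin 3)).lintegral_comp hf]
  have hf' : Measurable fun y : Fin 3 → ℝ => f (WithLp.toLp 2 y) :=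
    hf.comp (PiLp.continuous_toLp 2 _).measurable
  rw [← ((volume_preserving_piFinSuccAbove (fun _ : Fin 3 => ℝ) 2).symm).lintegral_comp hf']
  have hf'' := hf'.comp (MeasurableEquiv.piFinSuccAbove (fun _ : Fin 3 => ℝ) 2).symm.measurable
  rw [Measure.volume_eq_prod]
  refine (lintegral_prod_symm' _ hf'').trans ?_
  have hm : Measurable fun X : Plane => ∫⁻ t : ℝ, f (spacePoint X t) :=
    Measurable.lintegral_prod_right' (hf.comp continuous_spacePoint.measurable)
  rw [← (PiLp.volume_preserving_toLp (Fin 2)).lintegral_comp hm]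
  refine lintegral_congr fun X => lintegral_congr fun t => ?_
  refine congrArg f (PiLp.ext fun i => ?_)
  fin_cases i <;> rfl

theorem lintegral_plane {f : Plane → ℝ≥0∞} (hf : Measurable f) :
    ∫⁻ X, f X = ∫⁻ p : ℝ × ℝ, f !₂[p.1, p.2] := by
  rw [← (PiLp.volume_preserving_toLp (Fin 2)).lintegral_comp hf]
  have hf' : Measurable fun y : Fin 2 → ℝ => f (WithLp.toLp 2 y) :=
    hf.comp (PiLp.continuous_toLp 2 _).measurable
  rw [← ((volume_preserving_finTwoArrow ℝ).symm).lintegral_comp hf']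
  rfl

theorem lintegral_plane_radial {H : ℝ → ℝ≥0∞} (hH : Measurable H) :
    ∫⁻ X : Plane, H ‖X‖ =
      ENNReal.ofReal (2 * Real.pi) * ∫⁻ ρ in Ioi (0 : ℝ), ENNReal.ofReal ρ * H ρ := by
  rw [lintegral_plane (f := fun X => H ‖X‖) (hH.comp measurable_norm),
    ← lintegral_comp_polarCoord_symm, polarCoord_target, Measure.volume_eq_prod, ← Measure.prod_restrict]
  have e : ∀ p ∈ Ioi (0 : ℝ) ×ˢ Ioo (-Real.pi) Real.pi,
      ENNReal.ofReal p.1 • H ‖(!₂[(polarCoord.symm p).1, (polarCoord.symm p).2] : Plane)‖ =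
        ENNReal.ofReal p.1 * H p.1 := by
    rintro ⟨ρ, θ⟩ ⟨hρ, -⟩
    have : ‖(!₂[ρ * Real.cos θ, ρ * Real.sin θ] : Plane)‖ = ρ := by
      rw [← sq_eq_sq₀ (norm_nonneg _) (le_of_lt hρ), plane_norm_sq]
      simp
      linear_combination ρ ^ 2 * Real.sin_sq_add_cos_sq θ
    simp [polarCoord_symm_apply, this]
  rw [Measure.prod_restrict, setLIntegral_congr_fun
    (measurableSet_Ioi.prod measurableSet_Ioo) e, ← Measure.prod_restrict,
    lintegral_prod _ (by fun_prop)]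
  simp only [lintegral_const, Measure.restrict_apply_univ, Real.volume_Ioo]
  rw [lintegral_mul_const _ (by fun_prop), mul_comm]
  congr 2
  ring

/-! ### Averaging the potential over directions -/

/-- The length of the vector potential of the solid angle form at a unit vector, as a function of
the length `s` of the direction and its component `m` along the vector. -/
def potentialProfile (s m : ℝ) : ℝ := √((s ^ 2 - m ^ 2) / (s - m) ^ 2)

theorem measurable_potentialProfile :
    Measurable fun p : ℝ × ℝ => potentialProfile p.1 p.2 := by
  unfold potentialProfile; fun_prop

/-- Homogeneity of degree $-1$ in $y$ reduces the length to that at a unit vector. -/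
theorem norm_potential (q : Space) {y : Space} (hy : y ≠ 0) :
    ‖potential q y‖ = ‖y‖⁻¹ * potentialProfile ‖q‖ (inner ℝ q (‖y‖⁻¹ • y)) := by
  have hr : ‖y‖ ≠ 0 := norm_ne_zero_iff.2 hy
  rw [← Real.sqrt_sq (norm_nonneg (potential q y)), norm_potential_sq, potentialProfile,
    inner_smul_right]
  have e : (‖q‖ ^ 2 * ‖y‖ ^ 2 - (inner ℝ q y : ℝ) ^ 2) / potentialDenom q y ^ 2 =
      (‖y‖⁻¹) ^ 2 * ((‖q‖ ^ 2 - (‖y‖⁻¹ * inner ℝ q y) ^ 2) / (‖q‖ - ‖y‖⁻¹ * inner ℝ q y) ^ 2) := by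
    have hD : potentialDenom q y = ‖y‖ ^ 2 * (‖q‖ - ‖y‖⁻¹ * inner ℝ q y) := by
      unfold potentialDenom; field_simp
    rw [hD]
    field_simp
  rw [e, Real.sqrt_mul (by positivity), Real.sqrt_sq (by positivity)]

/-- At angle $\theta$ to $q$ the length is $\cot(\theta/2)=(1+\cos\theta)/\sin\theta$; the volume
factor $\sin\theta$ removes its singularity. -/
theorem mul_potentialProfile_polar {r θ : ℝ} (hr : 0 < r) (h0 : 0 < θ) (hπ : θ < Real.pi) :
    (r * Real.sin θ) * potentialProfile r (r * Real.cos θ) = r * (1 + Real.cos θ) := by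
  have hs : 0 < Real.sin θ := Real.sin_pos_of_pos_of_lt_pi h0 hπ
  have hc : Real.cos θ < 1 := by nlinarith [Real.sin_sq_add_cos_sq θ]
  have hc' : -1 < Real.cos θ := by nlinarith [Real.sin_sq_add_cos_sq θ]
  have h1 : (r ^ 2 - (r * Real.cos θ) ^ 2) / (r - r * Real.cos θ) ^ 2 =
      ((1 + Real.cos θ) / Real.sin θ) ^ 2 := by
    have : 1 - Real.cos θ ≠ 0 := by linarith
    have e : r - r * Real.cos θ = r * (1 - Real.cos θ) := by ring
    rw [e]
    field_simp
    linear_combination (1 - Real.cos θ ^ 2 ) * Real.sin_sq_add_cos_sq θ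
  rw [potentialProfile, h1, Real.sqrt_sq (by apply div_nonneg <;> linarith)]
  field_simp

theorem lintegral_one_add_cos :
    ∫⁻ θ in Ioo 0 Real.pi, ENNReal.ofReal (1 + Real.cos θ) = ENNReal.ofReal Real.pi := by
  rw [← ofReal_integral_eq_lintegral_ofReal]
  · rw [← integral_Ioc_eq_integral_Ioo, ← intervalIntegral.integral_of_le Real.pi_pos.le,
      intervalIntegral.integral_add (by simp) (by simp)]
    simp
  · exact ((by fun_prop : Continuous fun θ : ℝ => 1 + Real.cos θ).integrableOn_Icc).mono_set
      Ioo_subset_Icc_self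
  · exact Eventually.of_forall fun θ => by simp; linarith [Real.neg_one_le_cos θ]

theorem lintegral_Ioo_sq {c : ℝ} (hc : 0 ≤ c) :
    ∫⁻ t in Ioo 0 c, ENNReal.ofReal (t ^ 2) = ENNReal.ofReal (c ^ 3 / 3) := by
  rw [← ofReal_integral_eq_lintegral_ofReal]
  · rw [← integral_Ioc_eq_integral_Ioo, ← intervalIntegral.integral_of_le hc, integral_pow]
    norm_num
  · exact ((by fun_prop : Continuous fun θ : ℝ => θ ^ 2).integrableOn_Icc).mono_set
      Ioo_subset_Icc_self
  · exact Eventually.of_forall fun θ => by positivity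

/-- Spherical coordinates about the third axis, obtained as cylindrical coordinates followed by
polar ones in the half-plane of height and radius. The constant is
$2\pi\cdot\int_0^1r^2\,dr\cdot\int_0^\pi(1+\cos\theta)\,d\theta$. -/
theorem lintegral_ball_potentialProfile_le :
    ∫⁻ q in Metric.ball (0 : Space) 1, ENNReal.ofReal (potentialProfile ‖q‖ (q 2)) ≤
      ENNReal.ofReal (2 * Real.pi ^ 2 / 3) := by
  set G : ℝ × ℝ → ℝ≥0∞ := fun p => {p : ℝ × ℝ | p.1 ^ 2 + p.2 ^ 2 < 1}.indicator
    (fun p => ENNReal.ofReal (potentialProfile (√(p.1 ^ 2 + p.2 ^ 2)) p.1)) p with hG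
  have hGm : Measurable G := by
    refine Measurable.indicator ?_ ?_
    · exact (measurable_potentialProfile.comp
        (by fun_prop : Measurable fun p : ℝ × ℝ => (√(p.1 ^ 2 + p.2 ^ 2), p.1))).ennreal_ofReal
    · exact measurableSet_lt (by fun_prop) measurable_const
  have e1 : ∀ (X : Plane) (t : ℝ), (Metric.ball (0 : Space) 1).indicator
      (fun q => ENNReal.ofReal (potentialProfile ‖q‖ (q 2))) (spacePoint X t) = G (t, ‖X‖) := by
    intro X t
    have hn : ‖spacePoint X t‖ = √(t ^ 2 + ‖X‖ ^ 2) := by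
      rw [add_comm, ← norm_spacePoint_sq, Real.sqrt_sq (norm_nonneg _)]
    have hmem : spacePoint X t ∈ Metric.ball (0 : Space) 1 ↔ t ^ 2 + ‖X‖ ^ 2 < 1 := by
      rw [mem_ball_zero_iff, add_comm, ← norm_spacePoint_sq, sq_lt_one_iff₀ (norm_nonneg _)]
    simp only [hG, indicator, hmem, mem_ofPred_eq, hn, spacePoint_two]
  have hmeas : Measurable fun q : Space => ENNReal.ofReal (potentialProfile ‖q‖ (q 2)) :=
    (measurable_potentialProfile.comp
      (by fun_prop : Measurable fun q : Space => (‖q‖, q 2))).ennreal_ofReal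
  rw [← lintegral_indicator measurableSet_ball, lintegral_space (hmeas.indicator measurableSet_ball)]
  simp only [e1]
  rw [lintegral_plane_radial (H := fun ρ => ∫⁻ t, G (t, ρ)) hGm.lintegral_prod_left']
  -- The factor $\rho$ and the constraint $\rho>0$ go into the integrand, so that polar coordinates
  -- apply to the whole plane.
  set F : ℝ × ℝ → ℝ≥0∞ := fun p => (Ioi (0 : ℝ)).indicator (fun ρ => ENNReal.ofReal ρ) p.2 * G p
    with hF
  have hFm : Measurable F :=
    ((Measurable.indicator (by fun_prop) measurableSet_Ioi).comp measurable_snd).mul hGm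
  have e2 : ∫⁻ ρ in Ioi (0 : ℝ), ENNReal.ofReal ρ * ∫⁻ t, G (t, ρ) = ∫⁻ p, F p := by
    rw [Measure.volume_eq_prod, lintegral_prod_symm' _ hFm, ← lintegral_indicator measurableSet_Ioi]
    refine lintegral_congr fun ρ => ?_
    simp only [hF]
    rw [lintegral_const_mul _ (by fun_prop)]
    by_cases hρ : ρ ∈ Ioi (0 : ℝ) <;> simp [hρ]
  rw [e2, ← lintegral_comp_polarCoord_symm, polarCoord_target]
  have e3 : ∀ p ∈ Ioi (0 : ℝ) ×ˢ Ioo (-Real.pi) Real.pi,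
      ENNReal.ofReal p.1 • F (polarCoord.symm p) ≤
        (Ioo (0 : ℝ) 1).indicator (fun r => ENNReal.ofReal (r ^ 2)) p.1 *
          (Ioo 0 Real.pi).indicator (fun θ => ENNReal.ofReal (1 + Real.cos θ)) p.2 := by
    rintro ⟨r, θ⟩ ⟨hr, hθ⟩
    simp only [mem_Ioi] at hr
    have hsq : (r * Real.cos θ) ^ 2 + (r * Real.sin θ) ^ 2 = r ^ 2 := by
      linear_combination r ^ 2 * Real.sin_sq_add_cos_sq θ
    simp only [polarCoord_symm_apply, hF, hG, indicator, mem_ofPred_eq, hsq, mem_Ioi, mem_Ioo, hr,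
      true_and, sq_lt_one_iff₀ hr.le, smul_eq_mul, Real.sqrt_sq hr.le]
    by_cases h1 : r < 1
    swap
    · simp [h1]
    by_cases h2 : 0 < r * Real.sin θ
    swap
    · simp [h2]
    have hs : 0 < Real.sin θ := pos_of_mul_pos_right h2 hr.le
    have hθ0 : 0 < θ := by
      by_contra h
      have := Real.sin_nonpos_of_nonpos_of_neg_pi_le (not_lt.1 h) hθ.1.le
      linarith
    simp only [h1, h2, hθ0, hθ.2, if_true, and_self]
    rw [← ENNReal.ofReal_mul h2.le, mul_potentialProfile_polar hr hθ0 hθ.2,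
      ← ENNReal.ofReal_mul hr.le, ← ENNReal.ofReal_mul (by positivity)]
    exact le_of_eq (by ring_nf)
  refine (mul_le_mul_right (setLIntegral_mono' (measurableSet_Ioi.prod measurableSet_Ioo) e3)
    _).trans ?_
  refine (mul_le_mul_right (setLIntegral_le_lintegral _ _) _).trans ?_
  rw [Measure.volume_eq_prod, lintegral_prod_mul, lintegral_indicator measurableSet_Ioo,
    lintegral_indicator measurableSet_Ioo, lintegral_one_add_cos, lintegral_Ioo_sq zero_le_one,
    ← ENNReal.ofReal_mul (by norm_num), ← ENNReal.ofReal_mul (by positivity)]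
  · exact le_of_eq (by ring_nf)
  · exact (Measurable.indicator (by fun_prop) measurableSet_Ioo).aemeasurable
  · exact (Measurable.indicator (by fun_prop) measurableSet_Ioo).aemeasurable

theorem lintegral_ball_norm_potential_le {y : Space} (hy : y ≠ 0) :
    ∫⁻ q in Metric.ball (0 : Space) 1, ENNReal.ofReal ‖potential q y‖ ≤
      ENNReal.ofReal (2 * Real.pi ^ 2 / 3 / ‖y‖) := by
  have hr : 0 < ‖y‖ := norm_pos_iff.2 hy
  set e : Space := ‖y‖⁻¹ • y with he
  have hen : ‖e‖ = 1 := by rw [he, norm_smul, norm_inv, norm_norm, inv_mul_cancel₀ hr.ne']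
  set e₂ : Space := EuclideanSpace.single 2 1 with he2
  have he2n : ‖e₂‖ = 1 := by simp [he2]
  -- By rotational symmetry of the ball, a reflection that takes the third axis to $y/|y|$ reduces
  -- to that axis.
  let R : Space ≃ₗᵢ[ℝ] Space := (ℝ ∙ (e₂ - e))ᗮ.reflection
  have hR : R e₂ = e := Submodule.reflection_sub (he2n.trans hen.symm)
  have key : ∫⁻ q in Metric.ball (0 : Space) 1,
      ENNReal.ofReal (potentialProfile ‖q‖ (inner ℝ q e)) =
      ∫⁻ q in Metric.ball (0 : Space) 1, ENNReal.ofReal (potentialProfile ‖q‖ (q 2)) := by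
    rw [← R.measurePreserving.setLIntegral_comp_preimage_emb
      R.toMeasurableEquiv.measurableEmbedding]
    have hpre : R ⁻¹' Metric.ball (0 : Space) 1 = Metric.ball 0 1 := by simp
    rw [hpre]
    refine lintegral_congr fun q => ?_
    have : (inner ℝ q e₂ : ℝ) = q 2 := by
      rw [he2, inner_eq_coord]; simp
    rw [R.norm_map, ← hR, R.inner_map_map, this]
  have : ∀ q, ENNReal.ofReal ‖potential q y‖ = ENNReal.ofReal (‖y‖⁻¹) *
      ENNReal.ofReal (potentialProfile ‖q‖ (inner ℝ q e)) := fun q => by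
    rw [norm_potential q hy, ENNReal.ofReal_mul (by positivity)]
  simp only [this]
  rw [lintegral_const_mul' _ _ ENNReal.ofReal_ne_top, key]
  refine (mul_le_mul_right lintegral_ball_potentialProfile_le _).trans ?_
  rw [← ENNReal.ofReal_mul (by positivity)]
  exact le_of_eq (by ring_nf)

/-! ### Volume of the cone over a surface -/

/-- The classical partial derivative of a map from the plane to space. -/
def spacePartial (i : Fin 2) (u : Plane → Space) (X : Plane) : Space :=
  fderiv ℝ u X (EuclideanSpace.single i 1)

/-- The solid angle form `y · (a × b)` pulled back by `u`, without normalization. -/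
def jacobian (u : Plane → Space) (X : Plane) : ℝ :=
  inner ℝ (u X) (cross (spacePartial 0 u X) (spacePartial 1 u X))

/-- The projection of space to its first two coordinates. -/
def horizontal : Space →L[ℝ] Plane :=
  LinearMap.toContinuousLinearMap
    { toFun := fun y => !₂[y 0, y 1]
      map_add' := fun a b => by ext i; fin_cases i <;> simp
      map_smul' := fun c a => by ext i; fin_cases i <;> simp }

@[simp] theorem horizontal_spacePoint (X : Plane) (t : ℝ) : horizontal (spacePoint X t) = X := by
  ext i; fin_cases i <;> rfl

/-- The cone over the surface parametrized by `u`. -/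
def coneMap (u : Plane → Space) (y : Space) : Space := y 2 • u (horizontal y)

/-- The parameters of the points of the unit ball on the cone over those points of `u '' K` that
have length at least `1/2`. -/
def coneDomain (u : Plane → Space) (K : Set Plane) : Set Space :=
  {y | 0 ≤ y 2 ∧ y 2 * ‖u (horizontal y)‖ < 1 ∧ horizontal y ∈ K ∧ 1 / 2 ≤ ‖u (horizontal y)‖}

/-- The density of the solid angle form, cut off near the origin. -/
def solidWeight (y : Space) : ℝ := if 1 / 2 ≤ ‖y‖ then (‖y‖ ^ 3)⁻¹ else 0

theorem det_eq_inner_cross (L : Space →L[ℝ] Space) :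
    L.det = inner ℝ (L (EuclideanSpace.single 2 1))
      (cross (L (EuclideanSpace.single 0 1)) (L (EuclideanSpace.single 1 1))) := by
  rw [ContinuousLinearMap.det,
    ← LinearMap.det_toMatrix (EuclideanSpace.basisFun (Fin 3) ℝ).toBasis, Matrix.det_fin_three]
  simp only [LinearMap.toMatrix_apply, inner_eq_coord, cross_zero_coord, cross_one_coord,
    cross_two_coord]
  simp
  ring

theorem hasFDerivAt_coneMap {u : Plane → Space} (hu : Differentiable ℝ u) (y : Space) :
    HasFDerivAt (coneMap u) (y 2 • (fderiv ℝ u (horizontal y)).comp horizontal +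
      (EuclideanSpace.proj (2 : Fin 3) : Space →L[ℝ] ℝ).smulRight (u (horizontal y))) y :=
  (EuclideanSpace.proj (2 : Fin 3) : Space →L[ℝ] ℝ).hasFDerivAt.smul
    ((hu (horizontal y)).hasFDerivAt.comp y horizontal.hasFDerivAt)

/-- At height $t$ the columns of the derivative are $t\,\partial_1u$, $t\,\partial_2u$ and $u$. -/
theorem det_fderiv_coneMap {u : Plane → Space} (hu : Differentiable ℝ u) (y : Space) :
    (fderiv ℝ (coneMap u) y).det = y 2 ^ 2 * jacobian u (horizontal y) := by
  rw [(hasFDerivAt_coneMap hu y).fderiv, det_eq_inner_cross]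
  have h0 : horizontal (EuclideanSpace.single 0 1) = EuclideanSpace.single 0 1 := by
    ext i; fin_cases i <;> simp [horizontal]
  have h1 : horizontal (EuclideanSpace.single 1 1) = EuclideanSpace.single 1 1 := by
    ext i; fin_cases i <;> simp [horizontal]
  have h2 : horizontal (EuclideanSpace.single 2 1) = 0 := by
    ext i; fin_cases i <;> simp [horizontal]
  simp [h0, h1, h2, jacobian, spacePartial, inner_eq_coord, cross_zero_coord, cross_one_coord,
    cross_two_coord]
  ring

theorem measurable_solidWeight : Measurable solidWeight := by
  unfold solidWeight
  exact Measurable.ite (measurableSet_le measurable_const measurable_norm) (by fun_prop)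
    measurable_const

theorem continuous_spacePartial {u : Plane → Space} (hu : ContDiff ℝ 1 u) (i : Fin 2) :
    Continuous (spacePartial i u) :=
  (hu.continuous_fderiv (by simp)).clm_apply continuous_const

theorem continuous_jacobian {u : Plane → Space} (hu : ContDiff ℝ 1 u) :
    Continuous (jacobian u) :=
  hu.continuous.inner (continuous_cross.comp
    ((continuous_spacePartial hu 0).prodMk (continuous_spacePartial hu 1)))

theorem measurableSet_coneDomain {u : Plane → Space} (hu : Continuous u) {K : Set Plane}
    (hK : MeasurableSet K) : MeasurableSet (coneDomain u K) := by
  have hm : Measurable fun y : Space => ‖u (horizontal y)‖ :=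
    (hu.comp horizontal.continuous).norm.measurable
  have h2 : Measurable fun y : Space => y 2 := by fun_prop
  exact (measurableSet_le measurable_const h2).inter
    ((measurableSet_lt (h2.mul hm) measurable_const).inter
      ((horizontal.continuous.measurable hK).inter (measurableSet_le measurable_const hm)))

/-- The volume of an image is at most the integral of the absolute Jacobian. Over each $X$ the
heights run over $0\le t<1/|u|$, and $\int t^2\,dt=|u|^{-3}/3$ produces the solid angle weight. -/
theorem volume_cone_le {u : Plane → Space} (hu : ContDiff ℝ 1 u) {K : Set Plane}
    (hK : MeasurableSet K) :
    volume (coneMap u '' coneDomain u K) ≤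
      ∫⁻ X in K, ENNReal.ofReal (solidWeight (u X) * |jacobian u X| / 3) := by
  have hd : Differentiable ℝ u := hu.differentiable (by simp)
  have hS := measurableSet_coneDomain hu.continuous hK
  refine (addHaar_image_le_lintegral_abs_det_fderiv volume hS fun y _ =>
    ((hasFDerivAt_coneMap hd y).differentiableAt.hasFDerivAt).hasFDerivWithinAt).trans ?_
  simp only [det_fderiv_coneMap hd]
  have hj : Measurable fun y : Space => ENNReal.ofReal |y 2 ^ 2 * jacobian u (horizontal y)| := by
    have := (continuous_jacobian hu).comp horizontal.continuous
    have h2 : Continuous fun y : Space => y 2 := by fun_prop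
    exact ((h2.pow 2).mul this).abs.measurable.ennreal_ofReal
  rw [← lintegral_indicator hS, lintegral_space (hj.indicator hS), ← lintegral_indicator hK]
  refine lintegral_mono fun X => ?_
  by_cases hX : X ∈ K ∧ 1 / 2 ≤ ‖u X‖
  swap
  · have : ∀ t, (coneDomain u K).indicator
        (fun y => ENNReal.ofReal |y 2 ^ 2 * jacobian u (horizontal y)|) (spacePoint X t) = 0 := by
      intro t
      refine indicator_of_notMem (fun h => hX ?_) _
      simpa using h.2.2
    simp only [this, lintegral_zero, zero_le]
  have hn : 0 < ‖u X‖ := lt_of_lt_of_le (by norm_num) hX.2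
  have : ∀ t, (coneDomain u K).indicator
      (fun y => ENNReal.ofReal |y 2 ^ 2 * jacobian u (horizontal y)|) (spacePoint X t) =
      ENNReal.ofReal |jacobian u X| *
        (Ico 0 (‖u X‖⁻¹)).indicator (fun t => ENNReal.ofReal (t ^ 2)) t := by
    intro t
    have hmem : spacePoint X t ∈ coneDomain u K ↔ t ∈ Ico 0 (‖u X‖⁻¹) := by
      simp only [coneDomain, mem_ofPred_eq, spacePoint_two, horizontal_spacePoint, hX.1, hX.2,
        and_true, mem_Ico]
      rw [← lt_div_iff₀ hn, one_div]
    by_cases h : t ∈ Ico 0 (‖u X‖⁻¹)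
    · rw [indicator_of_mem (hmem.2 h), indicator_of_mem h, ← ENNReal.ofReal_mul (abs_nonneg _)]
      simp [abs_mul, mul_comm]
    · rw [indicator_of_notMem (mt hmem.1 h), indicator_of_notMem h, mul_zero]
  simp only [this]
  rw [lintegral_const_mul' _ _ ENNReal.ofReal_ne_top, lintegral_indicator measurableSet_Ico,
    ← restrict_Ioo_eq_restrict_Ico, lintegral_Ioo_sq (by positivity), indicator_of_mem hX.1,
    ← ENNReal.ofReal_mul (abs_nonneg _), solidWeight, if_pos hX.2]
  exact le_of_eq (by ring_nf)

/-- A zero denominator is equality in the Cauchy–Schwarz inequality, so $q$ is a nonnegative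
multiple of $u(X)$. The case $q=0$ is the apex, which the cone contains because height $0$ is
allowed. -/
theorem mem_cone_of_potentialDenom_eq_zero {u : Plane → Space} {K : Set Plane} {q : Space}
    (hq : ‖q‖ < 1) {X : Plane} (hX : X ∈ K) (hu : 1 / 2 ≤ ‖u X‖)
    (h : potentialDenom q (u X) = 0) : q ∈ coneMap u '' coneDomain u K := by
  have hn : 0 < ‖u X‖ := lt_of_lt_of_le (by norm_num) hu
  have h1 : inner ℝ q (u X) = ‖q‖ * ‖u X‖ := by
    unfold potentialDenom at h
    refine mul_left_cancel₀ hn.ne' ?_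
    linear_combination -h
  rw [inner_eq_norm_mul_iff_real] at h1
  refine ⟨spacePoint X (‖q‖ / ‖u X‖), ⟨?_, ?_, ?_, ?_⟩, ?_⟩
  · simp; positivity
  · simp [hn.ne', hq]
  · simpa
  · simpa using hu
  · rw [coneMap, horizontal_spacePoint, spacePoint_two, div_eq_inv_mul, mul_smul, ← h1,
      inv_smul_smul₀ hn.ne']

/-! ### Stokes' theorem for pulled-back one-forms -/

theorem integral_partialDeriv_eq_zero {g : Plane → ℝ} (hg : ContDiff ℝ 1 g)
    (hc : HasCompactSupport g) (i : Fin 2) :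
    Integrable (partialDeriv i g) ∧ ∫ X, partialDeriv i g X = 0 := by
  have hint : Integrable (partialDeriv i g) :=
    ((hg.continuous_fderiv (by simp)).clm_apply continuous_const).integrable_of_hasCompactSupport
      (hc.fderiv_apply (𝕜 := ℝ) _)
  refine ⟨hint, ?_⟩
  have h := integral_mul_fderiv_eq_neg_fderiv_mul_of_integrable (μ := (volume : Measure Plane))
    (f := fun _ => (1 : ℝ)) (g := g) (v := EuclideanSpace.single i 1) (by simp)
    (by simp only [one_mul]; exact hint)
    (by simpa using hg.continuous.integrable_of_hasCompactSupport hc) (by simp)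
    (fun X _ => hg.differentiable (by simp) X)
  simpa [partialDeriv] using h

/-- The component of the pullback by `u` of the one-form given by the field `B`. -/
def pullback (B : Space → Space) (u : Plane → Space) (i : Fin 2) (X : Plane) : ℝ :=
  inner ℝ (B (u X)) (spacePartial i u X)

/-- The exterior derivative of `ζ` times the pullback by `u` of the one-form given by `B`. -/
def stokesIntegrand (B : Space → Space) (u : Plane → Space) (ζ : Plane → ℝ) (X : Plane) : ℝ :=
  ζ X * (inner ℝ (fderiv ℝ B (u X) (spacePartial 0 u X)) (spacePartial 1 u X) -
      inner ℝ (fderiv ℝ B (u X) (spacePartial 1 u X)) (spacePartial 0 u X)) +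
    (partialDeriv 0 ζ X * pullback B u 1 X - partialDeriv 1 ζ X * pullback B u 0 X)

theorem contDiff_spacePartial {u : Plane → Space} (hu : ContDiff ℝ ∞ u) (i : Fin 2) :
    ContDiff ℝ ∞ (spacePartial i u) :=
  (hu.fderiv_right (m := ∞) le_rfl).clm_apply contDiff_const

theorem spacePartial_comm {u : Plane → Space} (hu : ContDiff ℝ ∞ u) (X : Plane) :
    spacePartial 0 (spacePartial 1 u) X = spacePartial 1 (spacePartial 0 u) X := by
  have hd : DifferentiableAt ℝ (fderiv ℝ u) X :=
    (hu.fderiv_right (m := ∞) le_rfl).differentiable (by simp) X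
  have e : ∀ i j : Fin 2, spacePartial i (spacePartial j u) X =
      fderiv ℝ (fderiv ℝ u) X (EuclideanSpace.single i 1) (EuclideanSpace.single j 1) := by
    intro i j
    unfold spacePartial
    rw [fderiv_clm_apply hd (differentiableAt_const _)]
    simp
  have hs : IsSymmSndFDerivAt ℝ u X :=
    (contDiff_infty.1 hu 2).contDiffAt.isSymmSndFDerivAt (by simp)
  rw [e, e]
  exact hs _ _

theorem contDiffAt_pullback {B : Space → Space} {u : Plane → Space} (hu : ContDiff ℝ ∞ u)
    {X : Plane} (hB : ContDiffAt ℝ ∞ B (u X)) (i : Fin 2) :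
    ContDiffAt ℝ ∞ (pullback B u i) X :=
  (hB.comp X hu.contDiffAt).inner ℝ (contDiff_spacePartial hu i).contDiffAt

/-- The term with the second derivative of $u$ is symmetric in $i,j$ and so drops out of the
exterior derivative. -/
theorem partialDeriv_pullback {B : Space → Space} {u : Plane → Space} (hu : ContDiff ℝ ∞ u)
    {X : Plane} (hB : ContDiffAt ℝ ∞ B (u X)) (i j : Fin 2) :
    partialDeriv i (pullback B u j) X =
      inner ℝ (fderiv ℝ B (u X) (spacePartial i u X)) (spacePartial j u X) +
        inner ℝ (B (u X)) (spacePartial i (spacePartial j u) X) := by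
  have h1 : HasFDerivAt (fun X => B (u X)) ((fderiv ℝ B (u X)).comp (fderiv ℝ u X)) X :=
    (hB.differentiableAt (by simp)).hasFDerivAt.comp X
      (hu.differentiable (by simp) X).hasFDerivAt
  have h2 := ((contDiff_spacePartial hu j).differentiable (by simp) X).hasFDerivAt
  have h3 := h1.inner ℝ h2
  unfold partialDeriv pullback
  rw [h3.fderiv]
  simp [spacePartial, add_comm]

/-- The integrand is the exterior derivative of a compactly supported one-form. Smoothness of $B$ is
needed only along $u$ on the support of $\zeta$, which is what lets $B$ have a singular ray. -/
theorem stokes {B : Space → Space} {u : Plane → Space} {ζ : Plane → ℝ} (hu : ContDiff ℝ ∞ u)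
    (hζ : ContDiff ℝ ∞ ζ) (hc : HasCompactSupport ζ)
    (hB : ∀ X ∈ tsupport ζ, ContDiffAt ℝ ∞ B (u X)) :
    Integrable (stokesIntegrand B u ζ) ∧ ∫ X, stokesIntegrand B u ζ X = 0 := by
  have hsm : ∀ i, ContDiff ℝ 1 fun X => ζ X * pullback B u i X := by
    intro i
    rw [contDiff_iff_contDiffAt]
    intro X
    by_cases hX : X ∈ tsupport ζ
    · exact (hζ.contDiffAt.mul (contDiffAt_pullback hu (hB X hX) i)).of_le (by simp)
    · have : (fun X => ζ X * pullback B u i X) =ᶠ[𝓝 X] fun _ => 0 := by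
        filter_upwards [notMem_tsupport_iff_eventuallyEq.1 hX] with Y hY
        simp [hY]
      exact contDiffAt_const.congr_of_eventuallyEq this
  have hcs : ∀ i, HasCompactSupport fun X => ζ X * pullback B u i X := fun i => hc.mul_right
  have h01 := integral_partialDeriv_eq_zero (hsm 1) (hcs 1) 0
  have h10 := integral_partialDeriv_eq_zero (hsm 0) (hcs 0) 1
  have e : stokesIntegrand B u ζ = fun X => partialDeriv 0 (fun X => ζ X * pullback B u 1 X) X -
      partialDeriv 1 (fun X => ζ X * pullback B u 0 X) X := by
    ext X
    by_cases hX : X ∈ tsupport ζ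
    · have hd : ∀ i j, partialDeriv i (fun X => ζ X * pullback B u j X) X =
          ζ X * partialDeriv i (pullback B u j) X + partialDeriv i ζ X * pullback B u j X := by
        intro i j
        unfold partialDeriv
        rw [fderiv_fun_mul (hζ.differentiable (by simp) X)
          ((contDiffAt_pullback hu (hB X hX) j).differentiableAt (by simp))]
        simp [mul_comm]
      rw [hd, hd, partialDeriv_pullback hu (hB X hX), partialDeriv_pullback hu (hB X hX),
        spacePartial_comm hu, stokesIntegrand]
      ring
    · have hev := notMem_tsupport_iff_eventuallyEq.1 hX
      have hz : ∀ j, (fun X => ζ X * pullback B u j X) =ᶠ[𝓝 X] fun _ => 0 := fun j => by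
        filter_upwards [hev] with Y hY
        simp [hY]
      simp only [stokesIntegrand, partialDeriv, (hz _).fderiv_eq, hev.fderiv_eq, hev.eq_of_nhds]
      simp
  rw [e]
  exact ⟨h01.1.sub h10.1, by rw [integral_sub h01.1 h10.1, h01.2, h10.2, sub_zero]⟩

/-! ### Estimates for the cut-off potential -/

/-- The length of the gradient of a smooth map. -/
def smoothGradNorm (u : Plane → Space) (X : Plane) : ℝ :=
  √(‖spacePartial 0 u X‖ ^ 2 + ‖spacePartial 1 u X‖ ^ 2)

/-- The factor that multiplies the length of the potential in the estimate of the integrand in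
Stokes' theorem for the cut-off potential. -/
def errorDensity (u : Plane → Space) (ζ : Plane → ℝ) (X : Plane) : ℝ :=
  cutoff (u X) * smoothGradNorm u X * testGradNorm ζ X +
    2 * |ζ X| * ‖fderiv ℝ cutoff (u X)‖ * ‖spacePartial 0 u X‖ * ‖spacePartial 1 u X‖

theorem errorDensity_nonneg (u : Plane → Space) (ζ : Plane → ℝ) (X : Plane) :
    0 ≤ errorDensity u ζ X := by
  have := cutoff_nonneg (u X)
  unfold errorDensity smoothGradNorm testGradNorm
  positivity

/-- The cut-off solid angle form pulled back by `u`. -/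
def cutArea (u : Plane → Space) (X : Plane) : ℝ :=
  cutoff (u X) * (‖u X‖ ^ 3)⁻¹ * jacobian u X

theorem abs_mul_inner_sub_le (A a b : Space) (s t : ℝ) :
    |s * inner ℝ A b - t * inner ℝ A a| ≤
      ‖A‖ * (√(‖a‖ ^ 2 + ‖b‖ ^ 2) * √(s ^ 2 + t ^ 2)) := by
  have e : s * inner ℝ A b - t * inner ℝ A a = inner ℝ A (s • b - t • a) := by
    rw [inner_sub_right, real_inner_smul_right, real_inner_smul_right]
  rw [e]
  refine (abs_real_inner_le_norm _ _).trans (mul_le_mul_of_nonneg_left ?_ (norm_nonneg _))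
  refine (norm_sub_le _ _).trans ?_
  rw [norm_smul, norm_smul, Real.norm_eq_abs, Real.norm_eq_abs, ← Real.sqrt_mul (by positivity)]
  refine Real.le_sqrt_of_sq_le ?_
  rw [← sq_abs s, ← sq_abs t]
  nlinarith [sq_nonneg (|s| * ‖a‖ - |t| * ‖b‖)]

/-- Inside radius $1/2$ the product vanishes identically, so the singular ray matters only outside
that ball. -/
theorem cutoff_potential_contDiffAt {q y : Space} (h : 1 / 2 ≤ ‖y‖ → potentialDenom q y ≠ 0) :
    ContDiffAt ℝ ∞ (fun z => cutoff z • potential q z) y := by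
  by_cases hy : 1 / 2 ≤ ‖y‖
  · have : y ≠ 0 := norm_pos_iff.1 (lt_of_lt_of_le (by norm_num) hy)
    exact contDiff_cutoff.contDiffAt.smul (contDiffAt_potential q this (h hy))
  · have : (fun z => cutoff z • potential q z) =ᶠ[𝓝 y] fun _ => 0 := by
      filter_upwards [(continuous_norm.tendsto y).eventually_lt_const (not_le.1 hy)] with z hz
      simp [cutoff_eq_zero hz.le]
    exact contDiffAt_const.congr_of_eventuallyEq this

theorem fderiv_cutoff_potential {q y : Space} (hy : y ≠ 0) (h : potentialDenom q y ≠ 0)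
    (a b : Space) :
    inner ℝ (fderiv ℝ (fun z => cutoff z • potential q z) y a) b -
        inner ℝ (fderiv ℝ (fun z => cutoff z • potential q z) y b) a =
      -(cutoff y * (‖y‖ ^ 3)⁻¹ * inner ℝ y (cross a b)) +
        (fderiv ℝ cutoff y a * inner ℝ (potential q y) b -
          fderiv ℝ cutoff y b * inner ℝ (potential q y) a) := by
  rw [fderiv_fun_smul (contDiff_cutoff.differentiable (by simp) y)
    ((contDiffAt_potential q hy h).differentiableAt (by simp))]
  simp only [_root_.add_apply, _root_.smul_apply, ContinuousLinearMap.smulRight_apply,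
    inner_add_left, real_inner_smul_left]
  linear_combination cutoff y * fderiv_potential_alternating q a b hy h

/-- The curl of the potential cancels the cut-off area. What remains contains the potential
undifferentiated, paired once with $\nabla\zeta$ and once with the derivative of the cutoff. -/
theorem abs_cutArea_add_stokesIntegrand_le {q : Space} {u : Plane → Space} {ζ : Plane → ℝ}
    {X : Plane} (h : 1 / 2 ≤ ‖u X‖ → potentialDenom q (u X) ≠ 0) :
    |ζ X * cutArea u X + stokesIntegrand (fun z => cutoff z • potential q z) u ζ X| ≤
      ‖potential q (u X)‖ * errorDensity u ζ X := by
  by_cases hy : 1 / 2 ≤ ‖u X‖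
  · have hne : u X ≠ 0 := norm_pos_iff.1 (lt_of_lt_of_le (by norm_num) hy)
    have key := fderiv_cutoff_potential hne (h hy) (spacePartial 0 u X) (spacePartial 1 u X)
    rw [stokesIntegrand, key]
    simp only [cutArea, jacobian, pullback, real_inner_smul_left]
    set A := potential q (u X)
    set a := spacePartial 0 u X
    set b := spacePartial 1 u X
    have h1 := abs_mul_inner_sub_le A a b (partialDeriv 0 ζ X) (partialDeriv 1 ζ X)
    have hop : ∀ v, |fderiv ℝ cutoff (u X) v| ≤ ‖fderiv ℝ cutoff (u X)‖ * ‖v‖ := fun v =>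
      (fderiv ℝ cutoff (u X)).le_opNorm v
    have h2 : |fderiv ℝ cutoff (u X) a * inner ℝ A b - fderiv ℝ cutoff (u X) b * inner ℝ A a| ≤
        ‖A‖ * (2 * ‖fderiv ℝ cutoff (u X)‖ * ‖a‖ * ‖b‖) := by
      refine (abs_sub _ _).trans ?_
      rw [abs_mul, abs_mul]
      have h3 := mul_le_mul (hop a) (abs_real_inner_le_norm A b) (abs_nonneg _) (by positivity)
      have h4 := mul_le_mul (hop b) (abs_real_inner_le_norm A a) (abs_nonneg _) (by positivity)
      linarith
    have e : ∀ s t v z c d e f : ℝ, z * v + (z * (-v + s) + (c * (t * e) - d * (t * f))) =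
        z * s + t * (c * e - d * f) := by intros; ring
    rw [e]
    refine (abs_add_le _ _).trans ?_
    rw [abs_mul, abs_mul, abs_of_nonneg (cutoff_nonneg _)]
    have h5 := mul_le_mul_of_nonneg_left h2 (abs_nonneg (ζ X))
    have h6 := mul_le_mul_of_nonneg_left h1 (cutoff_nonneg (u X))
    refine (add_le_add h5 h6).trans (le_of_eq ?_)
    unfold errorDensity smoothGradNorm testGradNorm
    ring
  · have hlt := not_le.1 hy
    have hev : (fun z => cutoff z • potential q z) =ᶠ[𝓝 (u X)] fun _ => 0 := by
      filter_upwards [(continuous_norm.tendsto (u X)).eventually_lt_const hlt] with z hz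
      simp [cutoff_eq_zero hz.le]
    have : ζ X * cutArea u X + stokesIntegrand (fun z => cutoff z • potential q z) u ζ X = 0 := by
      simp only [cutArea, stokesIntegrand, pullback, hev.fderiv_eq, cutoff_eq_zero hlt.le]
      simp
    rw [this, abs_zero]
    exact mul_nonneg (norm_nonneg _) (errorDensity_nonneg u ζ X)

theorem inv_norm_pow_le {y : Space} (h : 1 / 2 ≤ ‖y‖) (k : ℕ) : (‖y‖ ^ k)⁻¹ ≤ 2 ^ k := by
  rw [← inv_pow]
  refine pow_le_pow_left₀ (by positivity) ?_ k
  rw [inv_le_comm₀ (by linarith) (by norm_num)]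
  linarith

theorem cutoff_mul_inv_norm_pow_mem (y : Space) (k : ℕ) :
    0 ≤ cutoff y * (‖y‖ ^ k)⁻¹ ∧ cutoff y * (‖y‖ ^ k)⁻¹ ≤ 2 ^ k := by
  refine ⟨mul_nonneg (cutoff_nonneg y) (by positivity), ?_⟩
  by_cases h : ‖y‖ ≤ 1 / 2
  · rw [cutoff_eq_zero h, zero_mul]; positivity
  · calc cutoff y * (‖y‖ ^ k)⁻¹ ≤ 1 * (‖y‖ ^ k)⁻¹ :=
        mul_le_mul_of_nonneg_right (cutoff_le_one y) (by positivity)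
      _ ≤ 2 ^ k := by rw [one_mul]; exact inv_norm_pow_le (not_le.1 h).le k

theorem solidWeight_mem (y : Space) : 0 ≤ solidWeight y ∧ solidWeight y ≤ 8 := by
  unfold solidWeight
  split_ifs with h
  · exact ⟨by positivity, (inv_norm_pow_le h 3).trans (by norm_num)⟩
  · norm_num

/-- The derivative of the cutoff is bounded and vanishes where $|y|<1/2$, hence where $|y|^{-1}$ is
large. -/
theorem exists_fderiv_cutoff_div_norm_le :
    ∃ C, 0 ≤ C ∧ ∀ y : Space, ‖fderiv ℝ cutoff y‖ * ‖y‖⁻¹ ≤ C := by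
  obtain ⟨C, hC⟩ := exists_norm_fderiv_cutoff_le
  have hC0 : 0 ≤ C := (norm_nonneg _).trans (hC 0)
  refine ⟨C * 2, by positivity, fun y => ?_⟩
  by_cases h : ‖y‖ < 1 / 2
  · rw [fderiv_cutoff_eq_zero_of_lt h]; simp; positivity
  · have := inv_norm_pow_le (not_lt.1 h) 1
    simp only [pow_one] at this
    exact mul_le_mul (hC y) this (by positivity) hC0

theorem continuous_fderiv_cutoff : Continuous (fderiv ℝ cutoff) :=
  contDiff_cutoff.continuous_fderiv (by simp)

theorem continuous_partialDeriv {ζ : Plane → ℝ} (hζ : ContDiff ℝ ∞ ζ) (i : Fin 2) :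
    Continuous (partialDeriv i ζ) :=
  (hζ.continuous_fderiv (by simp)).clm_apply continuous_const

theorem partialDeriv_eq_zero {ζ : Plane → ℝ} {X : Plane} (hX : X ∉ tsupport ζ) (i : Fin 2) :
    partialDeriv i ζ X = 0 := by
  simp [partialDeriv, (notMem_tsupport_iff_eventuallyEq.1 hX).fderiv_eq]

theorem testGradNorm_eq_zero {ζ : Plane → ℝ} {X : Plane} (hX : X ∉ tsupport ζ) :
    testGradNorm ζ X = 0 := by
  simp [testGradNorm, partialDeriv_eq_zero hX]

theorem continuous_testGradNorm {ζ : Plane → ℝ} (hζ : ContDiff ℝ ∞ ζ) :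
    Continuous (testGradNorm ζ) := by
  have h0 := continuous_partialDeriv hζ 0
  have h1 := continuous_partialDeriv hζ 1
  unfold testGradNorm
  fun_prop

theorem continuous_smoothGradNorm {u : Plane → Space} (hu : ContDiff ℝ 1 u) :
    Continuous (smoothGradNorm u) := by
  have h0 := continuous_spacePartial hu 0
  have h1 := continuous_spacePartial hu 1
  unfold smoothGradNorm
  fun_prop

theorem integrable_mul_cutArea {u : Plane → Space} {ζ : Plane → ℝ} (hu : ContDiff ℝ 1 u)
    (hζ : Continuous ζ) (hc : HasCompactSupport ζ) :
    Integrable fun X => ζ X * cutArea u X := by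
  have h1 : Integrable fun X => ζ X * jacobian u X :=
    (hζ.mul (continuous_jacobian hu)).integrable_of_hasCompactSupport hc.mul_right
  have h2 : Measurable fun X => cutoff (u X) * (‖u X‖ ^ 3)⁻¹ :=
    (contDiff_cutoff.continuous.comp hu.continuous).measurable.mul
      ((hu.continuous.norm.pow 3).measurable.inv)
  have h3 := h1.bdd_mul (c := 8) h2.aestronglyMeasurable (Eventually.of_forall fun X => by
    have := cutoff_mul_inv_norm_pow_mem (u X) 3
    rw [Real.norm_of_nonneg this.1]
    exact this.2.trans (by norm_num))
  refine h3.congr (Eventually.of_forall fun X => ?_)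
  simp only [cutArea]
  ring

theorem errorDensity_div_norm (u : Plane → Space) (ζ : Plane → ℝ) (X : Plane) :
    errorDensity u ζ X * ‖u X‖⁻¹ =
      cutoff (u X) * (‖u X‖ ^ 1)⁻¹ * (smoothGradNorm u X * testGradNorm ζ X) +
        ‖fderiv ℝ cutoff (u X)‖ * ‖u X‖⁻¹ *
          (2 * |ζ X| * (‖spacePartial 0 u X‖ * ‖spacePartial 1 u X‖)) := by
  rw [errorDensity, pow_one]; ring

theorem measurable_errorDensity {u : Plane → Space} {ζ : Plane → ℝ} (hu : ContDiff ℝ 1 u)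
    (hζ : ContDiff ℝ ∞ ζ) : Measurable (errorDensity u ζ) := by
  have h0 := (continuous_spacePartial hu 0).norm
  have h1 := (continuous_spacePartial hu 1).norm
  have h2 := continuous_smoothGradNorm hu
  have h3 := continuous_testGradNorm hζ
  have h4 := (continuous_fderiv_cutoff.comp hu.continuous).norm
  have h5 := contDiff_cutoff.continuous.comp hu.continuous
  exact (((h5.mul h2).mul h3).add
    ((((continuous_const.mul hζ.continuous.abs).mul h4).mul h0).mul h1)).measurable

theorem integrable_errorDensity_div_norm {u : Plane → Space} {ζ : Plane → ℝ}
    (hu : ContDiff ℝ 1 u) (hζ : ContDiff ℝ ∞ ζ) (hc : HasCompactSupport ζ) :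
    Integrable fun X => errorDensity u ζ X * ‖u X‖⁻¹ := by
  obtain ⟨C, -, hC⟩ := exists_fderiv_cutoff_div_norm_le
  simp only [errorDensity_div_norm]
  have hg : HasCompactSupport (testGradNorm ζ) :=
    HasCompactSupport.intro hc fun X hX => testGradNorm_eq_zero hX
  have i1 : Integrable fun X => smoothGradNorm u X * testGradNorm ζ X :=
    Continuous.integrable_of_hasCompactSupport
      ((continuous_smoothGradNorm hu).mul (continuous_testGradNorm hζ)) hg.mul_left
  have i2 : Integrable fun X =>
      2 * |ζ X| * (‖spacePartial 0 u X‖ * ‖spacePartial 1 u X‖) := by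
    refine Continuous.integrable_of_hasCompactSupport ?_ ?_
    · exact (continuous_const.mul hζ.continuous.abs).mul
        ((continuous_spacePartial hu 0).norm.mul (continuous_spacePartial hu 1).norm)
    · refine HasCompactSupport.intro hc fun X hX => ?_
      simp [image_eq_zero_of_notMem_tsupport hX]
  refine Integrable.add (i1.bdd_mul (c := 2 ^ 1) ?_ ?_) (i2.bdd_mul (c := C) ?_ ?_)
  · exact ((contDiff_cutoff.continuous.comp hu.continuous).measurable.mul
      ((hu.continuous.norm.pow 1).measurable.inv)).aestronglyMeasurable
  · refine Eventually.of_forall fun X => ?_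
    have := cutoff_mul_inv_norm_pow_mem (u X) 1
    rw [Real.norm_of_nonneg this.1]
    exact this.2
  · exact ((continuous_fderiv_cutoff.comp hu.continuous).norm.measurable.mul
      hu.continuous.norm.measurable.inv).aestronglyMeasurable
  · refine Eventually.of_forall fun X => ?_
    rw [Real.norm_of_nonneg (by positivity)]
    exact hC _

theorem integrableOn_solidWeight_mul {u : Plane → Space} (hu : ContDiff ℝ 1 u) {K : Set Plane}
    (hK : IsCompact K) : IntegrableOn (fun X => solidWeight (u X) * |jacobian u X|) K := by
  have h1 : IntegrableOn (fun X => |jacobian u X|) K :=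
    (continuous_jacobian hu).abs.continuousOn.integrableOn_compact hK
  refine h1.bdd_mul (c := 8) ?_ (Eventually.of_forall fun X => ?_)
  · exact (measurable_solidWeight.comp hu.continuous.measurable).aestronglyMeasurable
  · rw [Real.norm_of_nonneg (solidWeight_mem _).1]
    exact (solidWeight_mem _).2

/-! ### The estimate for smooth maps -/

theorem measurable_norm_potential_comp {u : Plane → Space} (hu : Continuous u) :
    Measurable fun p : Space × Plane => ‖potential p.1 (u p.2)‖ := by
  have hu' : Continuous fun p : Space × Plane => u p.2 := hu.comp continuous_snd
  have h1 : Continuous fun p : Space × Plane => potentialDenom p.1 (u p.2) := by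
    unfold potentialDenom
    have : Continuous fun p : Space × Plane => (inner ℝ p.1 (u p.2) : ℝ) :=
      continuous_fst.inner hu'
    fun_prop
  have h2 : Continuous fun p : Space × Plane => cross p.1 (u p.2) :=
    continuous_cross.comp (continuous_fst.prodMk hu')
  exact (h1.measurable.inv.smul h2.measurable).norm

/-- Off the cone the potential is smooth along $u$ wherever the cutoff is active, so adding the
Stokes integrand does not change the integral. -/
theorem ofReal_abs_integral_le {q : Space} {u : Plane → Space} {ζ : Plane → ℝ}
    (hu : ContDiff ℝ ∞ u) (hζ : ContDiff ℝ ∞ ζ) (hc : HasCompactSupport ζ) (hq : ‖q‖ < 1)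
    (hcone : q ∉ coneMap u '' coneDomain u (tsupport ζ)) :
    ENNReal.ofReal |∫ X, ζ X * cutArea u X| ≤
      ∫⁻ X, ENNReal.ofReal ‖potential q (u X)‖ * ENNReal.ofReal (errorDensity u ζ X) := by
  have hgood : ∀ X ∈ tsupport ζ, 1 / 2 ≤ ‖u X‖ → potentialDenom q (u X) ≠ 0 := fun X hX h h0 =>
    hcone (mem_cone_of_potentialDenom_eq_zero hq hX h h0)
  obtain ⟨hs, hs0⟩ := stokes hu hζ hc fun X hX => cutoff_potential_contDiffAt (hgood X hX)
  have hi := integrable_mul_cutArea (hu.of_le (by simp)) hζ.continuous hc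
  have e : ∫ X, ζ X * cutArea u X =
      ∫ X, (ζ X * cutArea u X + stokesIntegrand (fun z => cutoff z • potential q z) u ζ X) := by
    rw [integral_add hi hs, hs0, add_zero]
  rw [e, ← Real.norm_eq_abs, ofReal_norm]
  refine (enorm_integral_le_lintegral_enorm _).trans (lintegral_mono fun X => ?_)
  rw [← ofReal_norm, Real.norm_eq_abs, ← ENNReal.ofReal_mul (norm_nonneg _)]
  refine ENNReal.ofReal_le_ofReal ?_
  by_cases hX : X ∈ tsupport ζ
  · exact abs_cutArea_add_stokesIntegrand_le (hgood X hX)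
  · have h0 : ζ X = 0 := image_eq_zero_of_notMem_tsupport hX
    simp only [stokesIntegrand, h0, partialDeriv_eq_zero hX, zero_mul, sub_zero, add_zero, abs_zero]
    exact mul_nonneg (norm_nonneg _) (errorDensity_nonneg u ζ X)

/-- The estimate for smooth maps. -/
theorem abs_integral_cutArea_le {u : Plane → Space} {ζ : Plane → ℝ} (hu : ContDiff ℝ ∞ u)
    (hζ : ContDiff ℝ ∞ ζ) (hc : HasCompactSupport ζ) :
    (4 * Real.pi - ∫ X in tsupport ζ, solidWeight (u X) * |jacobian u X|) *
        |∫ X, ζ X * cutArea u X| ≤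
      2 * Real.pi ^ 2 * ∫ X, errorDensity u ζ X * ‖u X‖⁻¹ := by
  have hu1 : ContDiff ℝ 1 u := hu.of_le (by simp)
  set K := tsupport ζ with hKdef
  have hK : IsCompact K := hc
  set I := |∫ X, ζ X * cutArea u X| with hI
  set a := ∫ X in K, solidWeight (u X) * |jacobian u X| with ha
  have hR0 : 0 ≤ ∫ X, errorDensity u ζ X * ‖u X‖⁻¹ :=
    integral_nonneg fun X => mul_nonneg (errorDensity_nonneg u ζ X) (by positivity)
  set R := ∫ X, errorDensity u ζ X * ‖u X‖⁻¹ with hR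
  set f : Space → ℝ≥0∞ := fun q =>
    ∫⁻ X, ENNReal.ofReal ‖potential q (u X)‖ * ENNReal.ofReal (errorDensity u ζ X) with hf
  have hjoint : Measurable fun p : Space × Plane =>
      ENNReal.ofReal ‖potential p.1 (u p.2)‖ * ENNReal.ofReal (errorDensity u ζ p.2) :=
    (measurable_norm_potential_comp hu.continuous).ennreal_ofReal.mul
      ((measurable_errorDensity hu1 hζ).comp measurable_snd).ennreal_ofReal
  have hfm : Measurable f := hjoint.lintegral_prod_right'
  have upper : ∫⁻ q in Metric.ball (0 : Space) 1, f q ≤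
      ENNReal.ofReal (2 * Real.pi ^ 2 / 3 * R) := by
    rw [lintegral_lintegral_swap hjoint.aemeasurable]
    have : ∀ X, ∫⁻ q in Metric.ball (0 : Space) 1,
        ENNReal.ofReal ‖potential q (u X)‖ * ENNReal.ofReal (errorDensity u ζ X) ≤
        ENNReal.ofReal (2 * Real.pi ^ 2 / 3 * (errorDensity u ζ X * ‖u X‖⁻¹)) := by
      intro X
      rw [lintegral_mul_const' _ _ ENNReal.ofReal_ne_top]
      by_cases h0 : u X = 0
      -- Where $u=0$ the potential has no bound to offer, but the cutoff and its derivative both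
      -- vanish.
      · simp [h0, errorDensity, cutoff_eq_zero, fderiv_cutoff_eq_zero_of_lt]
      · refine (mul_le_mul_left (lintegral_ball_norm_potential_le h0) _).trans ?_
        rw [← ENNReal.ofReal_mul (by positivity)]
        exact le_of_eq (by ring_nf)
    refine (lintegral_mono this).trans ?_
    rw [hR, ← integral_const_mul, ofReal_integral_eq_lintegral_ofReal]
    · exact (integrable_errorDensity_div_norm hu1 hζ hc).const_mul _
    · exact Eventually.of_forall fun X =>
        mul_nonneg (by positivity) (mul_nonneg (errorDensity_nonneg u ζ X) (by positivity))
  have hvol : volume (coneMap u '' coneDomain u K) ≤ ENNReal.ofReal (a / 3) := by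
    refine (volume_cone_le hu1 hK.measurableSet).trans (le_of_eq ?_)
    rw [ha, ← integral_div, ofReal_integral_eq_lintegral_ofReal]
    · exact (integrableOn_solidWeight_mul hu1 hK).div_const 3
    · exact Eventually.of_forall fun X =>
        div_nonneg (mul_nonneg (solidWeight_mem _).1 (abs_nonneg _)) (by norm_num)
  have hsub : Metric.ball (0 : Space) 1 \ (coneMap u '' coneDomain u K) ⊆
      {q | ENNReal.ofReal I ≤ f q} ∩ Metric.ball 0 1 := by
    rintro q ⟨hq, hq'⟩
    exact ⟨ofReal_abs_integral_le hu hζ hc (mem_ball_zero_iff.1 hq) hq', hq⟩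
  -- The directions in the ball off the cone all satisfy $I\le f(q)$; their volume is at least that
  -- of the ball minus that of the cone.
  have hlow : ENNReal.ofReal (4 * Real.pi / 3 - a / 3) ≤
      volume.restrict (Metric.ball (0 : Space) 1) {q | ENNReal.ofReal I ≤ f q} := by
    have hball : volume (Metric.ball (0 : Space) 1) = ENNReal.ofReal (4 * Real.pi / 3) := by
      rw [EuclideanSpace.volume_ball_fin_three, ENNReal.ofReal_one, one_pow, one_mul]
      congr 1; ring
    have ha0 : 0 ≤ a := integral_nonneg fun X => mul_nonneg (solidWeight_mem _).1 (abs_nonneg _)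
    rw [Measure.restrict_apply (measurableSet_le measurable_const hfm),
      ENNReal.ofReal_sub _ (by positivity), ← hball]
    exact (tsub_le_tsub_left hvol _).trans (le_measure_sdiff.trans (measure_mono hsub))
  -- Chebyshev's inequality for $f$ at level $I$. If $a>4\pi$ the truncated factor is zero and the
  -- final bound is trivial.
  have hmain : ENNReal.ofReal I * ENNReal.ofReal (4 * Real.pi / 3 - a / 3) ≤
      ENNReal.ofReal (2 * Real.pi ^ 2 / 3 * R) :=
    (mul_le_mul_right hlow _).trans ((mul_meas_ge_le_lintegral hfm _).trans upper)
  rw [← ENNReal.ofReal_mul (abs_nonneg _), ENNReal.ofReal_le_ofReal_iff (by positivity)] at hmain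
  linarith

/-! ### Generalized dominated convergence -/

/-- Dominated convergence with a convergent sequence of dominating functions. -/
theorem tendsto_integral_of_dominating_sequence {α : Type*} [MeasurableSpace α] {μ : Measure α}
    {f : ℕ → α → ℝ} {g : ℕ → α → ℝ} {F G : α → ℝ}
    (hf : ∀ k, AEStronglyMeasurable (f k) μ) (hg : ∀ k, Integrable (g k) μ) (hG : Integrable G μ)
    (hfg : ∀ k, ∀ᵐ x ∂μ, |f k x| ≤ g k x)
    (hfF : ∀ᵐ x ∂μ, Tendsto (fun k => f k x) atTop (𝓝 (F x)))
    (hgG : ∀ᵐ x ∂μ, Tendsto (fun k => g k x) atTop (𝓝 (G x)))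
    (hint : Tendsto (fun k => ∫ x, g k x ∂μ) atTop (𝓝 (∫ x, G x ∂μ))) :
    Tendsto (fun k => ∫ x, f k x ∂μ) atTop (𝓝 (∫ x, F x ∂μ)) := by
  have hall : ∀ᵐ x ∂μ, ∀ k, |f k x| ≤ g k x := ae_all_iff.2 hfg
  have hFG : ∀ᵐ x ∂μ, |F x| ≤ G x := by
    filter_upwards [hall, hfF, hgG] with x h1 h2 h3
    exact le_of_tendsto_of_tendsto' h2.abs h3 h1
  have hfi : ∀ k, Integrable (f k) μ := fun k => (hg k).mono' (hf k) (hfg k)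
  -- Since $0\le(G-g_k)^+\le G$, ordinary dominated convergence applies to this part, although not
  -- to $g_k-G$ itself.
  set p : ℕ → α → ℝ := fun k x => max (G x - g k x) 0 with hp
  have hpi : ∀ k, Integrable (p k) μ := fun k => (hG.sub (hg k)).pos_part
  have hp0 : Tendsto (fun k => ∫ x, p k x ∂μ) atTop (𝓝 0) := by
    have := tendsto_integral_of_dominated_convergence (μ := μ) (F := p) (f := fun _ => (0 : ℝ)) G
      (fun k => (hpi k).aestronglyMeasurable) hG ?_ ?_
    · simpa using this
    · intro k
      filter_upwards [hFG, hfg k] with x h1 h2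
      rw [Real.norm_of_nonneg (le_max_right _ _)]
      exact max_le (by linarith [abs_nonneg (f k x)]) ((abs_nonneg _).trans h1)
    · filter_upwards [hgG] with x hx
      have := (tendsto_const_nhds (x := G x)).sub hx
      simpa [hp] using this.max (tendsto_const_nhds (x := (0 : ℝ)))
  -- Truncating $f_k$ to $[-G,G]$ gives functions with the fixed majorant $G$. The truncation error
  -- is at most $(g_k-G)^+=g_k-G+p_k$, whose integral tends to zero.
  set d : ℕ → α → ℝ := fun k x => max (-G x) (min (f k x) (G x)) with hd
  have hdm : ∀ k, AEStronglyMeasurable (d k) μ := fun k =>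
    hG.aestronglyMeasurable.neg.sup ((hf k).inf hG.aestronglyMeasurable)
  have hdb : ∀ k, ∀ᵐ x ∂μ, ‖d k x‖ ≤ G x := by
    intro k
    filter_upwards [hFG] with x h1
    have : 0 ≤ G x := (abs_nonneg _).trans h1
    exact abs_le.2 ⟨le_max_left _ _, max_le (by linarith) (min_le_right _ _)⟩
  have hdi : ∀ k, Integrable (d k) μ := fun k => hG.mono' (hdm k) (hdb k)
  have hdF : Tendsto (fun k => ∫ x, d k x ∂μ) atTop (𝓝 (∫ x, F x ∂μ)) := by
    refine tendsto_integral_of_dominated_convergence G hdm hG hdb ?_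
    filter_upwards [hfF, hFG] with x h1 h2
    have h3 := (tendsto_const_nhds (x := -G x)).max (h1.min (tendsto_const_nhds (x := G x)))
    rwa [min_eq_left (abs_le.1 h2).2, max_eq_right (abs_le.1 h2).1] at h3
  have hdiff : Tendsto (fun k => ∫ x, (f k x - d k x) ∂μ) atTop (𝓝 0) := by
    have hbound : Tendsto (fun k => ∫ x, (g k x - G x + p k x) ∂μ) atTop (𝓝 0) := by
      have e : ∀ k, ∫ x, (g k x - G x + p k x) ∂μ =
          (∫ x, g k x ∂μ - ∫ x, G x ∂μ) + ∫ x, p k x ∂μ := fun k => by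
        rw [← integral_sub (hg k) hG]
        exact integral_add ((hg k).sub hG) (hpi k)
      simp only [e]
      simpa using (hint.sub_const (∫ x, G x ∂μ)).add hp0
    refine squeeze_zero_norm (fun k => ?_) hbound
    refine norm_integral_le_of_norm_le (((hg k).sub hG).add (hpi k)) ?_
    filter_upwards [hfg k, hFG] with x h1 h2
    have h0 : 0 ≤ G x := (abs_nonneg _).trans h2
    obtain ⟨h3, h4⟩ := abs_le.1 h1
    simp only [hd, hp, Real.norm_eq_abs]
    rcases max_cases (-G x) (min (f k x) (G x)) with h | h <;>
    rcases min_cases (f k x) (G x) with h' | h' <;>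
    rcases max_cases (G x - g k x) 0 with h'' | h'' <;>
    rw [abs_le] <;> constructor <;> linarith
  have e : ∀ k, ∫ x, f k x ∂μ = ∫ x, (f k x - d k x) ∂μ + ∫ x, d k x ∂μ := fun k => by
    rw [integral_sub (hfi k) (hdi k)]; ring
  simp only [e]
  simpa using hdiff.add hdF

/-! ### Mollification -/

/-- A sequence of smooth bump functions on the plane supported in balls of radius at most `r`. -/
def mollifier {r : ℝ} (hr : 0 < r) (k : ℕ) : ContDiffBump (0 : Plane) where
  rIn := r / (k + 1) / 2
  rOut := r / (k + 1)
  rIn_pos := by positivity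
  rIn_lt_rOut := half_lt_self (by positivity)

theorem mollifier_rOut_le {r : ℝ} (hr : 0 < r) (k : ℕ) : (mollifier hr k).rOut ≤ r :=
  div_le_self hr.le (by simp)

/-- The kernel of the mollification. -/
def kernel {r : ℝ} (hr : 0 < r) (k : ℕ) : Plane → ℝ := (mollifier hr k).normed volume

section

variable {E : Type*} [NormedAddCommGroup E] [NormedSpace ℝ E]

/-- The mollification of a function on the plane. -/
def mollify {r : ℝ} (hr : 0 < r) (k : ℕ) (f : Plane → E) (X : Plane) : E :=
  ∫ Y, kernel hr k (X - Y) • f Y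

theorem contDiff_kernel {r : ℝ} (hr : 0 < r) (k : ℕ) : ContDiff ℝ ∞ (kernel hr k) :=
  (mollifier hr k).contDiff_normed

theorem hasCompactSupport_kernel {r : ℝ} (hr : 0 < r) (k : ℕ) :
    HasCompactSupport (kernel hr k) :=
  (mollifier hr k).hasCompactSupport_normed

theorem kernel_nonneg {r : ℝ} (hr : 0 < r) (k : ℕ) (X : Plane) : 0 ≤ kernel hr k X :=
  (mollifier hr k).nonneg_normed X

theorem integral_kernel {r : ℝ} (hr : 0 < r) (k : ℕ) : ∫ X, kernel hr k X = 1 :=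
  (mollifier hr k).integral_normed

theorem integrable_kernel {r : ℝ} (hr : 0 < r) (k : ℕ) : Integrable (kernel hr k) :=
  (mollifier hr k).integrable_normed

theorem tsupport_kernel_subset {r : ℝ} (hr : 0 < r) (k : ℕ) :
    tsupport (kernel hr k) ⊆ Metric.closedBall 0 r := by
  rw [kernel, (mollifier hr k).tsupport_normed_eq]
  exact Metric.closedBall_subset_closedBall (mollifier_rOut_le hr k)

theorem mollify_eq_convolution {r : ℝ} (hr : 0 < r) (k : ℕ) (f : Plane → E) :
    mollify hr k f = convolution f (kernel hr k) (ContinuousLinearMap.lsmul ℝ ℝ).flip volume := by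
  ext X
  rfl

theorem integrable_kernel_smul {r : ℝ} (hr : 0 < r) (k : ℕ) {f : Plane → E} (hf : Integrable f)
    (X : Plane) : Integrable fun Y => kernel hr k (X - Y) • f Y := by
  obtain ⟨C, hC⟩ := (contDiff_kernel hr k).continuous.bounded_above_of_compact_support
    (hasCompactSupport_kernel hr k)
  exact hf.bdd_smul C ((contDiff_kernel hr k).continuous.comp
    (continuous_const.sub continuous_id)).aestronglyMeasurable (Eventually.of_forall fun Y => hC _)

theorem mollify_eq_convolution_left {r : ℝ} (hr : 0 < r) (k : ℕ) (f : Plane → E) :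
    mollify hr k f = convolution (kernel hr k) f (ContinuousLinearMap.lsmul ℝ ℝ) volume := by
  rw [mollify_eq_convolution, convolution_flip]

theorem contDiff_mollify {r : ℝ} (hr : 0 < r) (k : ℕ) {f : Plane → E}
    (hf : LocallyIntegrable f) : ContDiff ℝ ∞ (mollify hr k f) := by
  rw [mollify_eq_convolution]
  exact (hasCompactSupport_kernel hr k).contDiff_convolution_right _ hf (contDiff_kernel hr k)

theorem ae_tendsto_mollify [CompleteSpace E] {r : ℝ} (hr : 0 < r) {f : Plane → E}
    (hf : LocallyIntegrable f) : ∀ᵐ X, Tendsto (fun k => mollify hr k f X) atTop (𝓝 (f X)) := by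
  simp only [mollify_eq_convolution_left]
  refine ContDiffBump.ae_convolution_tendsto_right_of_locallyIntegrable (K := 2)
    (φ := mollifier hr) ?_ ?_ hf
  · exact Tendsto.div_atTop tendsto_const_nhds
      (tendsto_atTop_add_const_right _ _ tendsto_natCast_atTop_atTop)
  · exact Eventually.of_forall fun k => by simp only [mollifier]; linarith

theorem integrable_mollify {r : ℝ} (hr : 0 < r) (k : ℕ) {f : Plane → E} (hf : Integrable f) :
    Integrable (mollify hr k f) := by
  rw [mollify_eq_convolution_left]
  exact (integrable_kernel hr k).integrable_convolution _ hf

theorem integral_mollify [CompleteSpace E] {r : ℝ} (hr : 0 < r) (k : ℕ) {f : Plane → E}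
    (hf : Integrable f) :
    ∫ X, mollify hr k f X = ∫ X, f X := by
  rw [mollify_eq_convolution_left, integral_convolution _ (integrable_kernel hr k) hf,
    integral_kernel]
  simp

/-- Jensen's inequality for mollifications. -/
theorem norm_mollify_sq_le {r : ℝ} (hr : 0 < r) (k : ℕ) {f : Plane → E} (hf : Integrable f)
    (hf2 : Integrable fun X => ‖f X‖ ^ 2) (X : Plane) :
    ‖mollify hr k f X‖ ^ 2 ≤ mollify hr k (fun Y => ‖f Y‖ ^ 2) X := by
  have i1 := integrable_kernel_smul hr k hf.norm X
  have i2 := integrable_kernel_smul hr k hf2 X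
  have i0 : Integrable fun Y => kernel hr k (X - Y) := (integrable_kernel hr k).comp_sub_left X
  have h0 : ∫ Y, kernel hr k (X - Y) = 1 := by
    rw [integral_sub_left_eq_self (fun Y => kernel hr k Y), integral_kernel]
  set m := ∫ Y, kernel hr k (X - Y) • ‖f Y‖ with hm
  have h1 : ‖mollify hr k f X‖ ≤ m := by
    refine (norm_integral_le_integral_norm _).trans (le_of_eq ?_)
    refine integral_congr_ae (Eventually.of_forall fun Y => ?_)
    simp only [norm_smul, Real.norm_of_nonneg (kernel_nonneg hr k _), smul_eq_mul]
  -- The variance of $|f|$ under the probability density given by the recentred kernel is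
  -- nonnegative.
  have h2 : 0 ≤ ∫ Y, kernel hr k (X - Y) * (‖f Y‖ - m) ^ 2 :=
    integral_nonneg fun Y => mul_nonneg (kernel_nonneg hr k _) (sq_nonneg _)
  have h3 : ∫ Y, kernel hr k (X - Y) * (‖f Y‖ - m) ^ 2 =
      mollify hr k (fun Y => ‖f Y‖ ^ 2) X - 2 * m * m + m ^ 2 * 1 := by
    have e1 : ∫ Y, 2 * m * (kernel hr k (X - Y) • ‖f Y‖) = 2 * m * m := integral_const_mul _ _
    have e2 : ∫ Y, m ^ 2 * kernel hr k (X - Y) = m ^ 2 * 1 := by rw [integral_const_mul, h0]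
    rw [← e1, ← e2, mollify, ← integral_sub i2 (i1.const_mul _)]
    refine Eq.trans ?_ (integral_add (i2.sub (i1.const_mul _)) (i0.const_mul _))
    refine integral_congr_ae (Eventually.of_forall fun Y => ?_)
    simp only [smul_eq_mul]
    ring
  nlinarith [norm_nonneg (mollify hr k f X)]

end

/-- The extension of a map on the disc by zero. -/
def extend {E : Type*} [Zero E] (f : Plane → E) : Plane → E := disc.indicator f

theorem extend_of_mem {E : Type*} [Zero E] {f : Plane → E} {X : Plane} (hX : X ∈ disc) :
    extend f X = f X :=
  indicator_of_mem hX f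

theorem measurableSet_disc : MeasurableSet disc := measurableSet_closedBall

instance : IsFiniteMeasure discMeasure := by
  unfold discMeasure disc
  exact ⟨by simp⟩

theorem integrable_extend {f : Plane → Space} (hf : MemLp f 2 discMeasure) :
    Integrable (extend f) :=
  (integrable_indicator_iff measurableSet_disc).2 (hf.integrable (by norm_num))

theorem integrable_norm_extend_sq {f : Plane → Space} (hf : MemLp f 2 discMeasure) :
    Integrable fun X => ‖extend f X‖ ^ 2 := by
  have h : IntegrableOn (fun X => ‖f X‖ ^ 2) disc := (memLp_two_iff_integrable_sq_norm hf.1).1 hf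
  have e : (fun X => ‖extend f X‖ ^ 2) = disc.indicator fun X => ‖f X‖ ^ 2 := by
    ext X
    by_cases hX : X ∈ disc <;> simp [extend, hX]
  rw [e]
  exact (integrable_indicator_iff measurableSet_disc).2 h

theorem integral_smul_extend (g : Plane → ℝ) (f : Plane → Space) :
    ∫ X, g X • extend f X = ∫ X, g X • f X ∂discMeasure := by
  rw [discMeasure, ← integral_indicator measurableSet_disc]
  refine integral_congr_ae (Eventually.of_forall fun X => ?_)
  by_cases hX : X ∈ disc <;> simp [extend, hX]

/-- Mollification commutes with weak derivatives away from the boundary. -/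
theorem spacePartial_mollify {n v : Plane → Space} {i : Fin 2} (hn : MemLp n 2 discMeasure)
    (hv : IsWeakPartial i n v) {r : ℝ} (hr : 0 < r) (k : ℕ) {X : Plane}
    (hX : Metric.closedBall X r ⊆ Metric.ball 0 1) :
    spacePartial i (mollify hr k (extend n)) X = mollify hr k (extend v) X := by
  have hli := (integrable_extend hn).locallyIntegrable
  have hd := (hasCompactSupport_kernel hr k).hasFDerivAt_convolution_right
    (ContinuousLinearMap.lsmul ℝ ℝ : ℝ →L[ℝ] Space →L[ℝ] Space).flip hli
    ((contDiff_kernel hr k).of_le (by simp)) X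
  rw [← mollify_eq_convolution] at hd
  rw [spacePartial, hd.fderiv, convolution_precompR_apply _ hli
    ((hasCompactSupport_kernel hr k).fderiv (𝕜 := ℝ))
    ((contDiff_kernel hr k).continuous_fderiv (by simp))]
  -- As the ball of radius $r$ about $X$ lies in the open disc, the recentred kernel may test the
  -- weak derivative. The sign from differentiating in $Y$ cancels the one in the definition of the
  -- weak derivative.
  have htest : IsTestFunction fun Y => kernel hr k (X - Y) := by
    have hts : tsupport (fun Y => kernel hr k (X - Y)) ⊆ Metric.closedBall X r := by
      have h : Function.support (fun Y => kernel hr k (X - Y)) ⊆ Metric.closedBall X r := by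
        intro Y hY
        have := tsupport_kernel_subset hr k (subset_tsupport _ hY)
        rwa [mem_closedBall_zero_iff, ← dist_eq_norm, dist_comm] at this
      exact closure_minimal h Metric.isClosed_closedBall
    refine ⟨(contDiff_kernel hr k).comp (contDiff_const.sub contDiff_id), ?_, hts.trans hX⟩
    exact (isCompact_closedBall X r).of_isClosed_subset (isClosed_tsupport _) hts
  have hw := hv.2 _ htest
  have hpd : ∀ Y, partialDeriv i (fun Y => kernel hr k (X - Y)) Y =
      -(fderiv ℝ (kernel hr k) (X - Y) (EuclideanSpace.single i 1)) := by
    intro Y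
    have h1 : HasFDerivAt (fun Y => kernel hr k (X - Y)) _ Y :=
      (((contDiff_kernel hr k).differentiable (by simp) (X - Y)).hasFDerivAt).comp Y
        ((hasFDerivAt_id Y).const_sub X)
    rw [partialDeriv, h1.fderiv]
    simp
  simp only [hpd, neg_smul, integral_neg, neg_inj] at hw
  rw [mollify, integral_smul_extend, ← hw, ← integral_smul_extend]
  rfl

/-! ### Passage to the limit from mollified maps -/

theorem abs_inner_cross_le {c : ℝ} (hc : 0 ≤ c) {M : ℝ} (y a b : Space) (h : c * ‖y‖ ≤ M) :
    c * |inner ℝ y (cross a b)| ≤ M * (‖a‖ ^ 2 + ‖b‖ ^ 2) := by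
  have hM : 0 ≤ M := (mul_nonneg hc (norm_nonneg y)).trans h
  have h1 : |inner ℝ y (cross a b)| ≤ ‖y‖ * (‖a‖ * ‖b‖) :=
    (abs_real_inner_le_norm _ _).trans
      (mul_le_mul_of_nonneg_left (norm_cross_le a b) (norm_nonneg _))
  have h2 : ‖a‖ * ‖b‖ ≤ ‖a‖ ^ 2 + ‖b‖ ^ 2 := by
    nlinarith [sq_nonneg (‖a‖ - ‖b‖), sq_nonneg ‖a‖, sq_nonneg ‖b‖]
  calc c * |inner ℝ y (cross a b)| ≤ c * (‖y‖ * (‖a‖ * ‖b‖)) := mul_le_mul_of_nonneg_left h1 hc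
    _ = (c * ‖y‖) * (‖a‖ * ‖b‖) := by ring
    _ ≤ M * (‖a‖ ^ 2 + ‖b‖ ^ 2) := mul_le_mul h h2 (by positivity) hM

theorem inv_norm_cube_mul_norm (y : Space) : (‖y‖ ^ 3)⁻¹ * ‖y‖ = (‖y‖ ^ 2)⁻¹ := by
  by_cases h : ‖y‖ = 0
  · simp [h]
  · field_simp

theorem solidWeight_mul_norm_le (y : Space) : solidWeight y * ‖y‖ ≤ 4 := by
  unfold solidWeight
  split_ifs with h
  · rw [inv_norm_cube_mul_norm]
    exact (inv_norm_pow_le h 2).trans (by norm_num)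
  · norm_num

theorem cutoff_mul_inv_norm_cube_mul_norm_le (y : Space) :
    cutoff y * (‖y‖ ^ 3)⁻¹ * ‖y‖ ≤ 4 := by
  rw [mul_assoc, inv_norm_cube_mul_norm]
  exact (cutoff_mul_inv_norm_pow_mem y 2).2.trans (by norm_num)

theorem tendsto_solidWeight {u : ℕ → Space} {y : Space} (hy : ‖y‖ = 1)
    (h : Tendsto u atTop (𝓝 y)) : Tendsto (fun k => solidWeight (u k)) atTop (𝓝 1) := by
  have h1 : Tendsto (fun k => (‖u k‖ ^ 3)⁻¹) atTop (𝓝 1) := by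
    simpa [hy] using (h.norm.pow 3).inv₀ (by rw [hy]; norm_num)
  refine h1.congr' ?_
  filter_upwards [h.norm.eventually_const_lt (by rw [hy]; norm_num : 1 / 2 < ‖y‖)] with k hk
  rw [solidWeight, if_pos hk.le]

theorem tendsto_cutoff_mul {u : ℕ → Space} {y : Space} (hy : ‖y‖ = 1)
    (h : Tendsto u atTop (𝓝 y)) (m : ℕ) :
    Tendsto (fun k => cutoff (u k) * (‖u k‖ ^ m)⁻¹) atTop (𝓝 1) := by
  have h1 : Tendsto (fun k => (‖u k‖ ^ m)⁻¹) atTop (𝓝 1) := by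
    simpa [hy] using (h.norm.pow m).inv₀ (by rw [hy]; norm_num)
  have h2 : Tendsto (fun k => cutoff (u k)) atTop (𝓝 1) := by
    have := (contDiff_cutoff.continuous.tendsto y).comp h
    rwa [cutoff_eq_one (by rw [hy]; norm_num)] at this
  simpa using h2.mul h1

/-- The cutoff is constant near the unit sphere, so the terms are eventually zero. -/
theorem tendsto_fderiv_cutoff_mul {u : ℕ → Space} {y : Space} (hy : ‖y‖ = 1)
    (h : Tendsto u atTop (𝓝 y)) :
    Tendsto (fun k => ‖fderiv ℝ cutoff (u k)‖ * ‖u k‖⁻¹) atTop (𝓝 0) := by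
  refine tendsto_const_nhds.congr' ?_
  filter_upwards [h.norm.eventually_const_lt (by rw [hy]; norm_num : 3 / 4 < ‖y‖)] with k hk
  rw [fderiv_cutoff_eq_zero_of_gt hk]; simp

/-- The form of `area` with prescribed representatives of the weak derivatives. -/
def areaOf (n v w : Plane → Space) (X : Plane) : ℝ := inner ℝ (n X) (cross (v X) (w X))

/-- The length of the gradient with prescribed representatives of the weak derivatives. -/
def gradNormOf (v w : Plane → Space) (X : Plane) : ℝ := √(‖v X‖ ^ 2 + ‖w X‖ ^ 2)

theorem tendsto_jacobian {u : ℕ → Plane → Space} {n v w : Plane → Space} {X : Plane}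
    (h1 : Tendsto (fun k => u k X) atTop (𝓝 (n X)))
    (h2 : Tendsto (fun k => spacePartial 0 (u k) X) atTop (𝓝 (v X)))
    (h3 : Tendsto (fun k => spacePartial 1 (u k) X) atTop (𝓝 (w X))) :
    Tendsto (fun k => jacobian (u k) X) atTop (𝓝 (areaOf n v w X)) := by
  have hc := (continuous_cross.tendsto (v X, w X)).comp (h2.prodMk_nhds h3)
  simp only [Function.comp_def] at hc
  exact h1.inner hc

/-- Passage to the limit in integrals of functions of the mollified maps. -/
theorem tendsto_integral_of_mollify {n v w : Plane → Space} (hn : MemLp n 2 discMeasure)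
    (hv : IsWeakPartial 0 n v) (hw : IsWeakPartial 1 n w)
    (hs : ∀ᵐ X ∂discMeasure, n X ∈ Metric.sphere (0 : Space) 1) {K : Set Plane} (hK : IsCompact K)
    {r : ℝ} (hr : 0 < r) (hball : ∀ X ∈ K, Metric.closedBall X r ⊆ Metric.ball 0 1)
    {u : ℕ → Plane → Space} (hu : ∀ k, u k = mollify hr k (extend n)) {C : ℝ} (hC : 0 ≤ C)
    {f : ℕ → Plane → ℝ} {F : Plane → ℝ} (hfm : ∀ k, AEStronglyMeasurable (f k) volume)
    (hf0 : ∀ k, ∀ X ∉ K, f k X = 0) (hF0 : ∀ X ∉ K, F X = 0)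
    (hfb : ∀ k, ∀ X ∈ K, |f k X| ≤
      C * (‖spacePartial 0 (u k) X‖ ^ 2 + ‖spacePartial 1 (u k) X‖ ^ 2 + 1))
    (hlim : ∀ X ∈ K, ‖n X‖ = 1 → Tendsto (fun k => u k X) atTop (𝓝 (n X)) →
        Tendsto (fun k => spacePartial 0 (u k) X) atTop (𝓝 (v X)) →
        Tendsto (fun k => spacePartial 1 (u k) X) atTop (𝓝 (w X)) →
        Tendsto (fun k => f k X) atTop (𝓝 (F X))) :
    Tendsto (fun k => ∫ X, f k X) atTop (𝓝 (∫ X, F X)) := by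
  obtain rfl : u = fun k => mollify hr k (extend n) := funext hu
  have hKm : MeasurableSet K := hK.measurableSet
  have hKd : K ⊆ disc := fun X hX =>
    Metric.ball_subset_closedBall (hball X hX (Metric.mem_closedBall_self hr.le))
  have hdv : ∀ k, ∀ X ∈ K, spacePartial 0 (mollify hr k (extend n)) X =
      mollify hr k (extend v) X := fun k X hX => spacePartial_mollify hn hv hr k (hball X hX)
  have hdw : ∀ k, ∀ X ∈ K, spacePartial 1 (mollify hr k (extend n)) X =
      mollify hr k (extend w) X := fun k X hX => spacePartial_mollify hn hw hr k (hball X hX)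
  set h : Plane → ℝ := fun X => ‖extend v X‖ ^ 2 + ‖extend w X‖ ^ 2 with hh
  have hhi : Integrable h := (integrable_norm_extend_sq hv.1).add (integrable_norm_extend_sq hw.1)
  have hKi : Integrable (K.indicator fun _ => (1 : ℝ)) :=
    (integrable_indicator_iff hKm).2 (integrableOn_const hK.measure_lt_top.ne)
  have hsq : ∀ k, ∀ X ∈ K, ‖spacePartial 0 (mollify hr k (extend n)) X‖ ^ 2 +
      ‖spacePartial 1 (mollify hr k (extend n)) X‖ ^ 2 ≤
      mollify hr k h X := by
    intro k X hX
    rw [hdv k X hX, hdw k X hX]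
    refine (add_le_add
      (norm_mollify_sq_le hr k (integrable_extend hv.1) (integrable_norm_extend_sq hv.1) X)
      (norm_mollify_sq_le hr k (integrable_extend hw.1) (integrable_norm_extend_sq hw.1) X)).trans
      (le_of_eq ?_)
    rw [mollify, mollify, ← integral_add
      (integrable_kernel_smul hr k (integrable_norm_extend_sq hv.1) X)
      (integrable_kernel_smul hr k (integrable_norm_extend_sq hw.1) X)]
    exact integral_congr_ae (Eventually.of_forall fun Y => by simp only [hh, smul_eq_mul]; ring)
  have hh0 : ∀ k X, 0 ≤ mollify hr k h X := fun k X => integral_nonneg fun Y =>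
    mul_nonneg (kernel_nonneg hr k _) (by simp only [hh]; positivity)
  -- Jensen's inequality gives the majorants: mollifications of $|\nabla n|^2$ plus the indicator of
  -- $K$. They converge almost everywhere, and mollification preserves the integral.
  refine tendsto_integral_of_dominating_sequence
    (g := fun k X => C * (mollify hr k h X + K.indicator (fun _ => 1) X))
    (G := fun X => C * (h X + K.indicator (fun _ => 1) X)) hfm
    (fun k => ((integrable_mollify hr k hhi).add hKi).const_mul C)
    ((hhi.add hKi).const_mul C) (fun k => Eventually.of_forall fun X => ?_) ?_ ?_ ?_
  · by_cases hX : X ∈ K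
    · refine (hfb k X hX).trans (mul_le_mul_of_nonneg_left ?_ hC)
      rw [indicator_of_mem hX]
      linarith [hsq k X hX]
    · rw [hf0 k X hX, abs_zero, indicator_of_notMem hX]
      exact mul_nonneg hC (by linarith [hh0 k X])
  · filter_upwards [ae_tendsto_mollify hr (integrable_extend hn).locallyIntegrable,
      ae_tendsto_mollify hr (integrable_extend hv.1).locallyIntegrable,
      ae_tendsto_mollify hr (integrable_extend hw.1).locallyIntegrable,
      (ae_restrict_iff' measurableSet_disc).1 hs] with X h1 h2 h3 h4
    by_cases hX : X ∈ K
    · have hXd := hKd hX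
      rw [extend_of_mem hXd] at h1 h2 h3
      refine hlim X hX (mem_sphere_zero_iff_norm.1 (h4 hXd)) h1 ?_ ?_
      · simpa only [hdv _ X hX] using h2
      · simpa only [hdw _ X hX] using h3
    · simp only [hf0 _ X hX, hF0 X hX]
      exact tendsto_const_nhds
  · filter_upwards [ae_tendsto_mollify hr hhi.locallyIntegrable] with X hX
    exact (hX.add_const _).const_mul C
  · refine tendsto_const_nhds.congr fun k => ?_
    rw [integral_const_mul, integral_const_mul, integral_add hhi hKi,
      integral_add (integrable_mollify hr k hhi) hKi, integral_mollify hr k hhi]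

theorem abs_errorDensity_div_norm_le {u : Plane → Space} {ζ : Plane → ℝ} {X : Plane} {M M' C : ℝ}
    (hζM : |ζ X| ≤ M) (ht : testGradNorm ζ X ≤ M') (hC0 : 0 ≤ C)
    (hC : ∀ y : Space, ‖fderiv ℝ cutoff y‖ * ‖y‖⁻¹ ≤ C) :
    |errorDensity u ζ X * ‖u X‖⁻¹| ≤ (2 * M' + C * (2 * M)) *
      (‖spacePartial 0 u X‖ ^ 2 + ‖spacePartial 1 u X‖ ^ 2 + 1) := by
  rw [abs_of_nonneg (mul_nonneg (errorDensity_nonneg _ _ _) (by positivity)),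
    errorDensity_div_norm, add_mul]
  have h1 := cutoff_mul_inv_norm_pow_mem (u X) 1
  have hb : ‖spacePartial 0 u X‖ * ‖spacePartial 1 u X‖ ≤
      ‖spacePartial 0 u X‖ ^ 2 + ‖spacePartial 1 u X‖ ^ 2 + 1 := by
    nlinarith [sq_nonneg (‖spacePartial 0 u X‖ - ‖spacePartial 1 u X‖),
      sq_nonneg ‖spacePartial 0 u X‖, sq_nonneg ‖spacePartial 1 u X‖]
  have ha : smoothGradNorm u X ≤
      ‖spacePartial 0 u X‖ ^ 2 + ‖spacePartial 1 u X‖ ^ 2 + 1 := by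
    refine Real.sqrt_le_iff.2 ⟨by positivity, ?_⟩
    nlinarith [sq_nonneg (‖spacePartial 0 u X‖ ^ 2 + ‖spacePartial 1 u X‖ ^ 2),
      sq_nonneg ‖spacePartial 0 u X‖, sq_nonneg ‖spacePartial 1 u X‖]
  have ht0 : 0 ≤ testGradNorm ζ X := Real.sqrt_nonneg _
  have hM0 : 0 ≤ M := (abs_nonneg _).trans hζM
  have hM'0 : 0 ≤ M' := ht0.trans ht
  set S := ‖spacePartial 0 u X‖ ^ 2 + ‖spacePartial 1 u X‖ ^ 2 + 1 with hS
  have hS0 : 0 ≤ S := by positivity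
  refine add_le_add ?_ ?_
  · calc cutoff (u X) * (‖u X‖ ^ 1)⁻¹ * (smoothGradNorm u X * testGradNorm ζ X)
        ≤ 2 ^ 1 * (S * M') := mul_le_mul h1.2 (mul_le_mul ha ht ht0 hS0)
          (mul_nonneg (Real.sqrt_nonneg _) ht0) (by norm_num)
      _ = 2 * M' * S := by ring
  · calc ‖fderiv ℝ cutoff (u X)‖ * ‖u X‖⁻¹ *
          (2 * |ζ X| * (‖spacePartial 0 u X‖ * ‖spacePartial 1 u X‖))
        ≤ C * (2 * M * S) := mul_le_mul (hC _)
          (mul_le_mul (by linarith) hb (by positivity) (by positivity)) (by positivity) hC0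
      _ = C * (2 * M) * S := by ring

/-- The estimate for Sobolev maps into the sphere, localized to the support of the test function. -/
theorem abs_integral_areaOf_le {n v w : Plane → Space} (hn : MemLp n 2 discMeasure)
    (hv : IsWeakPartial 0 n v) (hw : IsWeakPartial 1 n w)
    (hs : ∀ᵐ X ∂discMeasure, n X ∈ Metric.sphere (0 : Space) 1) {ζ : Plane → ℝ}
    (hζ : IsTestFunction ζ) :
    (4 * Real.pi - ∫ X in tsupport ζ, |areaOf n v w X|) *
        |∫ X, areaOf n v w X * ζ X ∂discMeasure| ≤
      2 * Real.pi ^ 2 * ∫ X, gradNormOf v w X * testGradNorm ζ X ∂discMeasure := by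
  obtain ⟨hζs, hζc, hζK⟩ := hζ
  set K := tsupport ζ with hKdef
  have hK : IsCompact K := hζc
  have hKm : MeasurableSet K := hK.measurableSet
  have hKd : K ⊆ disc := hζK.trans Metric.ball_subset_closedBall
  -- This radius keeps every mollification ball centred on the support of $\zeta$ inside the open
  -- disc.
  obtain ⟨r, hr, hrK⟩ := hK.exists_cthickening_subset_open Metric.isOpen_ball hζK
  have hball : ∀ X ∈ K, Metric.closedBall X r ⊆ Metric.ball 0 1 := fun X hX =>
    (Metric.closedBall_subset_cthickening hX r).trans hrK
  obtain ⟨u, hu⟩ : ∃ u : ℕ → Plane → Space, ∀ k, u k = mollify hr k (extend n) :=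
    ⟨_, fun _ => rfl⟩
  have hus : ∀ k, ContDiff ℝ ∞ (u k) := fun k => by
    rw [hu]
    exact contDiff_mollify hr k (integrable_extend hn).locallyIntegrable
  have hus1 : ∀ k, ContDiff ℝ 1 (u k) := fun k => (hus k).of_le (by simp)
  obtain ⟨M, hM⟩ := hζs.continuous.bounded_above_of_compact_support hζc
  have hM0 : 0 ≤ M := (norm_nonneg _).trans (hM 0)
  obtain ⟨M', hM'⟩ := (continuous_testGradNorm hζs).bounded_above_of_compact_support
    (HasCompactSupport.intro hζc fun X hX => testGradNorm_eq_zero hX)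
  have hM'0 : 0 ≤ M' := (norm_nonneg _).trans (hM' 0)
  obtain ⟨C, hC0, hC⟩ := exists_fderiv_cutoff_div_norm_le
  have hz : ∀ X ∉ K, ζ X = 0 := fun X hX => image_eq_zero_of_notMem_tsupport hX
  have lim1 : Tendsto (fun k => ∫ X in K, solidWeight (u k X) * |jacobian (u k) X|) atTop
      (𝓝 (∫ X in K, |areaOf n v w X|)) := by
    simp only [← integral_indicator hKm]
    refine tendsto_integral_of_mollify hn hv hw hs hK hr hball hu (C := 4) (by norm_num)
      (fun k => ?_) (fun k X hX => indicator_of_notMem hX _)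
      (fun X hX => indicator_of_notMem hX _) (fun k X hX => ?_) (fun X hX hX1 h1 h2 h3 => ?_)
    · exact ((integrable_indicator_iff hKm).2
        (integrableOn_solidWeight_mul (hus1 k) hK)).aestronglyMeasurable
    · rw [indicator_of_mem hX, abs_of_nonneg (mul_nonneg (solidWeight_mem _).1 (abs_nonneg _))]
      refine (abs_inner_cross_le (solidWeight_mem _).1 _ _ _ (solidWeight_mul_norm_le _)).trans ?_
      linarith
    · simp only [indicator_of_mem hX]
      simpa using (tendsto_solidWeight hX1 h1).mul (tendsto_jacobian h1 h2 h3).abs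
  have lim2 : Tendsto (fun k => ∫ X, ζ X * cutArea (u k) X) atTop
      (𝓝 (∫ X, ζ X * areaOf n v w X)) := by
    refine tendsto_integral_of_mollify hn hv hw hs hK hr hball hu (C := M * 4)
      (by positivity) (fun k => ?_) (fun k X hX => by simp [hz X hX])
      (fun X hX => by simp [hz X hX]) (fun k X hX => ?_) (fun X hX hX1 h1 h2 h3 => ?_)
    · exact (integrable_mul_cutArea (hus1 k) hζs.continuous hζc).aestronglyMeasurable
    · have h1 := cutoff_mul_inv_norm_pow_mem (u k X) 3
      rw [cutArea, abs_mul, abs_mul, abs_of_nonneg h1.1, mul_assoc M]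
      refine mul_le_mul (hM X) ?_ (mul_nonneg h1.1 (abs_nonneg _)) hM0
      refine (abs_inner_cross_le h1.1 _ _ _ (cutoff_mul_inv_norm_cube_mul_norm_le _)).trans ?_
      linarith
    · simpa [cutArea] using
        ((tendsto_cutoff_mul hX1 h1 3).mul (tendsto_jacobian h1 h2 h3)).const_mul (ζ X)
  have lim3 : Tendsto (fun k => ∫ X, errorDensity (u k) ζ X * ‖u k X‖⁻¹) atTop
      (𝓝 (∫ X, gradNormOf v w X * testGradNorm ζ X)) := by
    refine tendsto_integral_of_mollify hn hv hw hs hK hr hball hu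
      (C := 2 * M' + C * (2 * M)) (by positivity) (fun k => ?_)
      (fun k X hX => by simp [errorDensity, hz X hX, testGradNorm_eq_zero hX])
      (fun X hX => by simp [testGradNorm_eq_zero hX]) (fun k X hX => ?_)
      (fun X hX hX1 h1 h2 h3 => ?_)
    · exact (integrable_errorDensity_div_norm (hus1 k) hζs hζc).aestronglyMeasurable
    · exact abs_errorDensity_div_norm_le (hM X) ((le_abs_self _).trans (hM' X)) hC0 hC
    · simp only [errorDensity_div_norm]
      have hg : Tendsto (fun k => smoothGradNorm (u k) X) atTop (𝓝 (gradNormOf v w X)) :=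
        ((h2.norm.pow 2).add (h3.norm.pow 2)).sqrt
      have t1 := (tendsto_cutoff_mul hX1 h1 1).mul (hg.mul_const (testGradNorm ζ X))
      -- The cutoff error leaves no trace in the limit, since its first factor tends to zero.
      have t2 := (tendsto_fderiv_cutoff_mul hX1 h1).mul
        ((h2.norm.mul h3.norm).const_mul (2 * |ζ X|))
      simpa using t1.add t2
  have key := le_of_tendsto_of_tendsto' ((lim1.const_sub (4 * Real.pi)).mul lim2.abs)
    (lim3.const_mul (2 * Real.pi ^ 2)) fun k => abs_integral_cutArea_le (hus k) hζs hζc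
  have e1 : ∫ X, areaOf n v w X * ζ X ∂discMeasure = ∫ X, ζ X * areaOf n v w X := by
    simp only [mul_comm]
    exact setIntegral_eq_integral_of_forall_compl_eq_zero fun X hX => by
      simp [hz X fun h => hX (hKd h)]
  have e2 : ∫ X, gradNormOf v w X * testGradNorm ζ X ∂discMeasure =
      ∫ X, gradNormOf v w X * testGradNorm ζ X :=
    setIntegral_eq_integral_of_forall_compl_eq_zero fun X hX => by
      simp [testGradNorm_eq_zero fun h => hX (hKd h)]
  rw [e1, e2]
  exact key

/-! ### Representation of functionals of the gradient -/

/-- A functional dominated by the norm of a linear map into a Hilbert space is represented by a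
vector. -/
theorem exists_inner_eq_of_abs_le {V H : Type*} [AddCommGroup V] [Module ℝ V]
    [NormedAddCommGroup H] [InnerProductSpace ℝ H] [CompleteSpace H] (G : V →ₗ[ℝ] H)
    (l : V →ₗ[ℝ] ℝ) {C : ℝ} (hC : 0 ≤ C) (h : ∀ v, |l v| ≤ C * ‖G v‖) :
    ∃ x : H, ‖x‖ ≤ C ∧ ∀ v, l v = inner ℝ x (G v) := by
  -- A linear section of $G$ over its range carries $l$ to that range, where Hahn–Banach and then
  -- Riesz apply.
  obtain ⟨g, hg⟩ := G.rangeRestrict.exists_rightInverse_of_surjective G.range_rangeRestrict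
  have hg' : ∀ y, G (g y) = y := fun y => congrArg Subtype.val (LinearMap.congr_fun hg y)
  obtain ⟨F, hF, hFn⟩ := exists_extension_norm_eq (LinearMap.range G)
    ((l.comp g).mkContinuous C fun y => by
      have := h (g y)
      rwa [hg'] at this)
  refine ⟨(InnerProductSpace.toDual ℝ H).symm F, ?_, fun v => ?_⟩
  · rw [LinearIsometryEquiv.norm_map, hFn]
    exact LinearMap.mkContinuous_norm_le _ hC _
  · rw [InnerProductSpace.toDual_symm_apply]
    have h1 := hF ⟨G v, LinearMap.mem_range_self G v⟩
    refine Eq.trans ?_ h1.symm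
    change l v = l (g ⟨G v, LinearMap.mem_range_self G v⟩)
    -- The bound forces $l$ to vanish on the kernel of $G$, so the choice of section is immaterial.
    have h2 := h (v - g ⟨G v, LinearMap.mem_range_self G v⟩)
    rw [map_sub, map_sub, hg', sub_self, norm_zero, mul_zero] at h2
    exact sub_eq_zero.1 (abs_nonpos_iff.1 h2)

/-- The space of test functions. -/
def testFunctions : Submodule ℝ (Plane → ℝ) where
  carrier := {ζ | IsTestFunction ζ}
  zero_mem' := ⟨contDiff_const, HasCompactSupport.zero, by simp⟩
  add_mem' := fun {a b} ha hb => ⟨ha.1.add hb.1, ha.2.1.add hb.2.1,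
    (tsupport_add a b).trans (union_subset ha.2.2 hb.2.2)⟩
  smul_mem' := fun c a ha => ⟨contDiff_const.smul ha.1, ha.2.1.smul_left,
    (tsupport_smul_subset_right (fun _ => c) a).trans ha.2.2⟩

/-- The gradient of a function on the plane. -/
def gradField (ζ : Plane → ℝ) (X : Plane) : Plane := !₂[partialDeriv 0 ζ X, partialDeriv 1 ζ X]

theorem norm_gradField (ζ : Plane → ℝ) (X : Plane) : ‖gradField ζ X‖ = testGradNorm ζ X := by
  rw [testGradNorm, ← Real.sqrt_sq (norm_nonneg (gradField ζ X)), plane_norm_sq]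
  simp [gradField]

theorem continuous_gradField {ζ : Plane → ℝ} (hζ : ContDiff ℝ ∞ ζ) :
    Continuous (gradField ζ) := by
  have h0 := continuous_partialDeriv hζ 0
  have h1 := continuous_partialDeriv hζ 1
  refine (PiLp.continuous_toLp 2 _).comp ?_
  refine continuous_pi fun i => ?_
  fin_cases i <;> simpa

theorem memLp_gradField {ζ : Plane → ℝ} (hζ : IsTestFunction ζ) :
    MemLp (gradField ζ) 2 discMeasure := by
  have hc : HasCompactSupport (gradField ζ) := HasCompactSupport.intro hζ.2.1 fun X hX => by
    rw [← norm_eq_zero, norm_gradField, testGradNorm_eq_zero hX]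
  exact ((continuous_gradField hζ.1).memLp_of_hasCompactSupport hc).restrict disc

theorem memLp_testGradNorm {ζ : Plane → ℝ} (hζ : IsTestFunction ζ) :
    MemLp (testGradNorm ζ) 2 discMeasure := by
  have := (memLp_gradField hζ).norm
  simpa only [norm_gradField] using this

theorem partialDeriv_add {ζ ξ : Plane → ℝ} (hζ : IsTestFunction ζ) (hξ : IsTestFunction ξ)
    (i : Fin 2) (X : Plane) :
    partialDeriv i (ζ + ξ) X = partialDeriv i ζ X + partialDeriv i ξ X := by
  rw [partialDeriv, fderiv_add (hζ.1.differentiable (by simp) X)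
    (hξ.1.differentiable (by simp) X)]
  rfl

theorem partialDeriv_smul {ζ : Plane → ℝ} (hζ : IsTestFunction ζ) (c : ℝ) (i : Fin 2)
    (X : Plane) : partialDeriv i (c • ζ) X = c * partialDeriv i ζ X := by
  rw [partialDeriv, fderiv_const_smul (hζ.1.differentiable (by simp) X)]
  rfl

/-- The gradient as a linear map from the test functions to the Hilbert space of square integrable
fields on the disc. -/
def gradL2 : testFunctions →ₗ[ℝ] Lp Plane 2 discMeasure where
  toFun := fun ζ => (memLp_gradField ζ.2).toLp
  map_add' := fun ζ ξ => by
    rw [← MemLp.toLp_add, MemLp.toLp_eq_toLp_iff]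
    refine Eventually.of_forall fun X => PiLp.ext fun i => ?_
    fin_cases i <;> simp [gradField, partialDeriv_add ζ.2 ξ.2]
  map_smul' := fun c ζ => by
    rw [RingHom.id_apply, ← MemLp.toLp_const_smul, MemLp.toLp_eq_toLp_iff]
    refine Eventually.of_forall fun X => PiLp.ext fun i => ?_
    fin_cases i <;> simp [gradField, partialDeriv_smul ζ.2]

theorem norm_gradL2 (ζ : testFunctions) :
    ‖gradL2 ζ‖ = (eLpNorm (testGradNorm ζ) 2 discMeasure).toReal := by
  change ‖(memLp_gradField ζ.2).toLp‖ = _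
  rw [Lp.norm_toLp, ← eLpNorm_norm]
  simp only [norm_gradField]

/-- The Cauchy–Schwarz inequality in terms of `eLpNorm`. -/
theorem integral_mul_le_eLpNorm {f g : Plane → ℝ} (hf : MemLp f 2 discMeasure)
    (hg : MemLp g 2 discMeasure) :
    ∫ X, f X * g X ∂discMeasure ≤
      (eLpNorm f 2 discMeasure).toReal * (eLpNorm g 2 discMeasure).toReal := by
  have h := real_inner_le_norm hf.toLp hg.toLp
  rw [Lp.norm_toLp, Lp.norm_toLp, L2.inner_def] at h
  refine (le_of_eq (integral_congr_ae ?_)).trans h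
  filter_upwards [hf.coeFn_toLp, hg.coeFn_toLp] with X h1 h2
  rw [h1, h2]
  simp [mul_comm]

/-! ### The bound for Sobolev maps into the sphere -/

theorem memLp_gradNorm {n : Plane → Space} (hn : MemW12 n) :
    MemLp (gradNorm n) 2 discMeasure := by
  have h0 := (isWeakPartial_weakPartial hn 0).1
  have h1 := (isWeakPartial_weakPartial hn 1).1
  refine (h0.norm.add h1.norm).of_le ?_ (Eventually.of_forall fun X => ?_)
  · exact Real.continuous_sqrt.comp_aestronglyMeasurable
      ((h0.1.norm.pow 2).add (h1.1.norm.pow 2))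
  · rw [gradNorm, Real.norm_of_nonneg (Real.sqrt_nonneg _)]
    refine (Real.sqrt_le_iff.2
      ⟨add_nonneg (norm_nonneg _) (norm_nonneg _), ?_⟩).trans (le_abs_self _)
    nlinarith [mul_nonneg (norm_nonneg (weakPartial 0 n X)) (norm_nonneg (weakPartial 1 n X))]

theorem integrable_cross_weakPartial {n : Plane → Space} (hn : MemW12 n) :
    Integrable (fun X => cross (weakPartial 0 n X) (weakPartial 1 n X)) discMeasure := by
  have h0 := (isWeakPartial_weakPartial hn 0).1
  have h1 := (isWeakPartial_weakPartial hn 1).1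
  refine (h0.norm.integrable_mul h1.norm).mono'
    (continuous_cross.comp_aestronglyMeasurable (h0.1.prodMk h1.1))
    (Eventually.of_forall fun X => norm_cross_le _ _)

theorem abs_area_le {n : Plane → Space} (hn : MemW12Sphere n) :
    ∀ᵐ X ∂discMeasure, |area n X| ≤ ‖cross (weakPartial 0 n X) (weakPartial 1 n X)‖ := by
  filter_upwards [hn.2] with X hX
  have := abs_real_inner_le_norm (n X) (cross (weakPartial 0 n X) (weakPartial 1 n X))
  rwa [mem_sphere_zero_iff_norm.1 hX, one_mul] at this

theorem integrable_area {n : Plane → Space} (hn : MemW12Sphere n) :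
    Integrable (area n) discMeasure := by
  have hc := integrable_cross_weakPartial hn.1
  exact hc.norm.mono' (hn.1.1.1.inner hc.1) (abs_area_le hn)

theorem integrable_area_mul {n : Plane → Space} (hn : MemW12Sphere n) {ζ : Plane → ℝ}
    (hζ : IsTestFunction ζ) : Integrable (fun X => area n X * ζ X) discMeasure := by
  obtain ⟨C, hC⟩ := hζ.1.continuous.bounded_above_of_compact_support hζ.2.1
  exact (integrable_area hn).mul_bdd hζ.1.continuous.aestronglyMeasurable
    (Eventually.of_forall hC)

theorem abs_integral_area_mul_le {n : Plane → Space} {δ : ℝ} (hδ : 0 < δ) (hn : MemW12Sphere n)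
    (h : ∫ X, ‖cross (weakPartial 0 n X) (weakPartial 1 n X)‖ ∂discMeasure ≤ 4 * Real.pi - δ)
    {ζ : Plane → ℝ} (hζ : IsTestFunction ζ) :
    |∫ X, area n X * ζ X ∂discMeasure| ≤
      8 * Real.pi / δ * (eLpNorm (gradNorm n) 2 discMeasure).toReal *
        (eLpNorm (testGradNorm ζ) 2 discMeasure).toReal := by
  have key := abs_integral_areaOf_le hn.1.1 (isWeakPartial_weakPartial hn.1 0)
    (isWeakPartial_weakPartial hn.1 1) hn.2 hζ
  change (4 * Real.pi - ∫ X in tsupport ζ, |area n X|) * |∫ X, area n X * ζ X ∂discMeasure| ≤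
    2 * Real.pi ^ 2 * ∫ X, gradNorm n X * testGradNorm ζ X ∂discMeasure at key
  -- Since $|n|=1$, $|\Phi|\le|\partial_1n\times\partial_2n|$, and the support of $\zeta$ lies in
  -- the disc.
  have h1 : ∫ X in tsupport ζ, |area n X| ≤ 4 * Real.pi - δ := by
    refine le_trans ?_ h
    refine le_trans ?_ (integral_mono_ae (integrable_area hn).abs
      (integrable_cross_weakPartial hn.1).norm (abs_area_le hn))
    exact setIntegral_mono_set (integrable_area hn).abs
      (Eventually.of_forall fun X => abs_nonneg _)
      (Eventually.of_forall (hζ.2.2.trans Metric.ball_subset_closedBall))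
  have h2 := integral_mul_le_eLpNorm (memLp_gradNorm hn.1) (memLp_testGradNorm hζ)
  set I := |∫ X, area n X * ζ X ∂discMeasure|
  set N := (eLpNorm (gradNorm n) 2 discMeasure).toReal
  set T := (eLpNorm (testGradNorm ζ) 2 discMeasure).toReal
  have hN : 0 ≤ N * T := mul_nonneg ENNReal.toReal_nonneg ENNReal.toReal_nonneg
  have h3 : δ * I ≤ 8 * Real.pi * (N * T) := by
    calc δ * I ≤ (4 * Real.pi - ∫ X in tsupport ζ, |area n X|) * I :=
          mul_le_mul_of_nonneg_right (by linarith) (abs_nonneg _)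
      _ ≤ 2 * Real.pi ^ 2 * (N * T) :=
          key.trans (mul_le_mul_of_nonneg_left h2 (by positivity))
      _ ≤ 8 * Real.pi * (N * T) :=
          -- The averaging constant $2\pi^2$ is at most $8\pi$ because $\pi\le4$.
          mul_le_mul_of_nonneg_right (by nlinarith [Real.pi_pos, Real.pi_le_four]) hN
  rw [mul_assoc, div_mul_eq_mul_div, le_div_iff₀ hδ, mul_comm]
  exact h3

end

end WeakArea

/-! ### The two assertions -/

theorem mainTheorem1 :
    ∃ c : ℝ, 0 < c ∧
      ∀ (n : WeakArea.Plane → WeakArea.Space) (δ : ℝ), 0 < δ → WeakArea.MemW12Sphere n →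
        ∫ X, ‖WeakArea.cross (WeakArea.weakPartial 0 n X) (WeakArea.weakPartial 1 n X)‖
            ∂WeakArea.discMeasure ≤ 4 * Real.pi - δ →
        (∃ Ω₁ Ω₂ : WeakArea.Plane → ℝ,
          MemLp Ω₁ 2 WeakArea.discMeasure ∧ MemLp Ω₂ 2 WeakArea.discMeasure ∧
          eLpNorm Ω₁ 2 WeakArea.discMeasure ≤ ENNReal.ofReal (8 * Real.pi / δ) *
            eLpNorm (WeakArea.gradNorm n) 2 WeakArea.discMeasure ∧
          eLpNorm Ω₂ 2 WeakArea.discMeasure ≤ ENNReal.ofReal (8 * Real.pi / δ) *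
            eLpNorm (WeakArea.gradNorm n) 2 WeakArea.discMeasure ∧
          ∀ ζ : WeakArea.Plane → ℝ, WeakArea.IsTestFunction ζ →
            ∫ X, WeakArea.area n X * ζ X ∂WeakArea.discMeasure =
              ∫ X, (Ω₂ X * WeakArea.partialDeriv 0 ζ X - Ω₁ X * WeakArea.partialDeriv 1 ζ X)
                ∂WeakArea.discMeasure) ∧
        WeakArea.negSobolevNorm (WeakArea.area n) ≤ ENNReal.ofReal (c / δ) *
          eLpNorm (WeakArea.gradNorm n) 2 WeakArea.discMeasure := by
  refine ⟨8 * Real.pi, by positivity, fun n δ hδ hn h => ?_⟩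
  have hest := fun {ζ : WeakArea.Plane → ℝ} (hζ : WeakArea.IsTestFunction ζ) =>
    WeakArea.abs_integral_area_mul_le hδ hn h hζ
  have hfin := (WeakArea.memLp_gradNorm hn.1).eLpNorm_ne_top
  have hc : 0 ≤ 8 * Real.pi / δ := by positivity
  have hconst : ENNReal.ofReal (8 * Real.pi / δ *
      (eLpNorm (WeakArea.gradNorm n) 2 WeakArea.discMeasure).toReal) =
      ENNReal.ofReal (8 * Real.pi / δ) *
        eLpNorm (WeakArea.gradNorm n) 2 WeakArea.discMeasure := by
    rw [ENNReal.ofReal_mul hc, ENNReal.ofReal_toReal hfin]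
  rw [← hconst]
  set N := (eLpNorm (WeakArea.gradNorm n) 2 WeakArea.discMeasure).toReal
  have hN : 0 ≤ 8 * Real.pi / δ * N := mul_nonneg hc ENNReal.toReal_nonneg
  constructor
  · obtain ⟨Θ, hΘ, hrep⟩ := WeakArea.exists_inner_eq_of_abs_le WeakArea.gradL2
      { toFun := fun ζ : WeakArea.testFunctions =>
          ∫ X, WeakArea.area n X * (ζ : WeakArea.Plane → ℝ) X ∂WeakArea.discMeasure
        map_add' := fun ζ ξ => by
          simp only [Submodule.coe_add, Pi.add_apply, mul_add]
          exact integral_add (WeakArea.integrable_area_mul hn ζ.2)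
            (WeakArea.integrable_area_mul hn ξ.2)
        map_smul' := fun c ζ => by
          simp only [Submodule.coe_smul, Pi.smul_apply, smul_eq_mul, RingHom.id_apply]
          rw [← integral_const_mul]
          exact integral_congr_ae (Eventually.of_forall fun X => by ring) } hN
      (fun ζ => by rw [WeakArea.norm_gradL2]; exact hest ζ.2)
    have hΘ2 : eLpNorm Θ 2 WeakArea.discMeasure ≤ ENNReal.ofReal (8 * Real.pi / δ * N) := by
      rw [← ENNReal.ofReal_toReal (Lp.eLpNorm_ne_top Θ), ← Lp.norm_def]
      exact ENNReal.ofReal_le_ofReal hΘ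
    have hcoord : ∀ i : Fin 2, MemLp (fun X => (Θ X) i) 2 WeakArea.discMeasure := fun i =>
      (EuclideanSpace.proj i : WeakArea.Plane →L[ℝ] ℝ).comp_memLp' (Lp.memLp Θ)
    -- Each coordinate is pointwise bounded by $|\Theta|$, so both inherit the full bound.
    have hcoordn : ∀ i : Fin 2, eLpNorm (fun X => (Θ X) i) 2 WeakArea.discMeasure ≤
        ENNReal.ofReal (8 * Real.pi / δ * N) := fun i =>
      (eLpNorm_mono fun X => PiLp.norm_apply_le (Θ X) i).trans hΘ2
    -- Matching $\Theta\cdot\nabla\zeta$ with $\Omega_2\,\partial_1\zeta-\Omega_1\,\partial_2\zeta$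
    -- forces $\Theta=(\Omega_2,-\Omega_1)$.
    refine ⟨fun X => -(Θ X) 1, fun X => (Θ X) 0, (hcoord 1).neg, hcoord 0, ?_, hcoordn 0,
      fun ζ hζ => ?_⟩
    · exact (eLpNorm_neg (fun X => (Θ X) 1) 2 WeakArea.discMeasure).le.trans (hcoordn 1)
    · refine (hrep ⟨ζ, hζ⟩).trans ?_
      rw [L2.inner_def]
      refine integral_congr_ae ?_
      filter_upwards [(WeakArea.memLp_gradField hζ).coeFn_toLp] with X hX
      have : WeakArea.gradL2 ⟨ζ, hζ⟩ X = WeakArea.gradField ζ X := hX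
      rw [this]
      simp [PiLp.inner_apply, Fin.sum_univ_two, WeakArea.gradField, mul_comm]
  · refine iSup_le fun ζ => iSup_le fun hζ => iSup_le fun h1 => ENNReal.ofReal_le_ofReal ?_
    refine (hest hζ).trans (mul_le_of_le_one_right hN ?_)
    exact ENNReal.toReal_le_of_le_ofReal zero_le_one (by simpa using h1)
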